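/- Let $d\ge 3$ and let $(S_n)_{n\ge 0}$ be a discrete-time simple random walk on $\mathbb{Z}^d$, with an arbitrary starting point (deterministic, or random and independent of the increments). For $x\in\mathbb{Z}^d$ and $n\ge 0$ let $\xi(x,n)=\#\{0\le j\le n: S_j=x\}$ be the local time of $x$ at time $n$, let $\xi^*(n)=\sup_{y\in\mathbb{Z}^d}\xi(y,n)$ be the maximal local time, and let $\mathcal{K}^{(d)}(n)=\{x\in\mathbb{Z}^d:\xi(x,n)=\xi^*(n)\}$ be the set of favorite sites at time $n$. Let $\gamma_d=\mathbb{P}[S_n\ne S_0 \text{ for all } n\ge 1]$ be the probability that the walk never returns to its starting point. Then $0<\gamma_d<1$, and almost surely $$\limsup_{n\to\infty}\frac{\#\mathcal{K}^{(d)}(n)}{\log\log n}=-\frac{1}{\log\gamma_d}.$$ -/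

import Mathlib

open MeasureTheory ProbabilityTheory Filter

/-- `S` is a (discrete-time) simple random walk on `ℤ^d` under the law `μ`, with an arbitrary,
possibly random, starting point: its increments are independent of each other and of the starting
point, and each increment is uniform on the `2d` unit vectors `± e_i`. -/
structure IsSimpleRandomWalk {Ω : Type*} [MeasurableSpace Ω] {d : ℕ}
    (S : ℕ → Ω → (Fin d → ℤ)) (μ : Measure Ω) : Prop where
  /-- Every position is a random variable. -/
  measurable : ∀ n, Measurable (S n)
  /-- The starting point is independent of the sequence of increments. -/
  indep_start : IndepFun (S 0) (fun ω (n : ℕ) => S (n + 1) ω - S n ω) μ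
  /-- The increments are mutually independent. -/
  indep_increments : iIndepFun (fun (n : ℕ) ω => S (n + 1) ω - S n ω) μ
  /-- Each increment takes each of the values `e_i` and `- e_i` with probability `1 / (2 d)`. -/
  step : ∀ (n : ℕ) (i : Fin d) (s : ℤˣ),
    μ {ω | S (n + 1) ω - S n ω = Pi.single i (s : ℤ)} = (2 * (d : ENNReal))⁻¹

/-- The local time of the site `x` at time `n` along the path `w`:
the number of `0 ≤ j ≤ n` with `w j = x`. -/
def localTime {d : ℕ} (w : ℕ → (Fin d → ℤ)) (x : Fin d → ℤ) (n : ℕ) : ℕ :=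
  ((Finset.range (n + 1)).filter (fun j => w j = x)).card

/-- Local times at time `n` are at most `n + 1`, so that their supremum is a genuine one. -/
theorem bddAbove_localTime {d : ℕ} (w : ℕ → (Fin d → ℤ)) (n : ℕ) :
    BddAbove (Set.range (fun y => localTime w y n)) := by
  refine ⟨n + 1, ?_⟩
  rintro _ ⟨y, rfl⟩
  exact (Finset.card_filter_le _ _).trans (by simp)

/-- The maximal local time at time `n`. -/
noncomputable def maxLocalTime {d : ℕ} (w : ℕ → (Fin d → ℤ)) (n : ℕ) : ℕ :=
  ⨆ y : Fin d → ℤ, localTime w y n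

/-- The set of favorite sites at time `n`: the sites whose local time is maximal. -/
def favoriteSites {d : ℕ} (w : ℕ → (Fin d → ℤ)) (n : ℕ) : Set (Fin d → ℤ) :=
  {x | localTime w x n = maxLocalTime w n}

/-- There are only finitely many favorite sites at any time, so that `Set.ncard` counts them. -/
theorem finite_favoriteSites {d : ℕ} (w : ℕ → (Fin d → ℤ)) (n : ℕ) :
    (favoriteSites w n).Finite := by
  refine ((Finset.range (n + 1)).image w).finite_toSet.subset ?_
  intro x hx
  have h1 : localTime w (w 0) n ≤ maxLocalTime w n := le_ciSup (bddAbove_localTime w n) (w 0)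
  have h0 : 0 < localTime w (w 0) n :=
    Finset.card_pos.mpr ⟨0, by simp⟩
  have hx' : localTime w x n = maxLocalTime w n := hx
  have h2 : 0 < localTime w x n := by omega
  obtain ⟨j, hj⟩ := Finset.card_pos.mp h2
  rw [Finset.mem_filter] at hj
  simp only [Finset.coe_image, Set.mem_image, Finset.mem_coe]
  exact ⟨j, hj.1, hj.2⟩

/-- The escape probability: the probability that the walk never returns to its starting point. -/
noncomputable def escapeProb {Ω : Type*} [MeasurableSpace Ω] {d : ℕ}
    (S : ℕ → Ω → (Fin d → ℤ)) (μ : Measure Ω) : ℝ :=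
  μ.real {ω | ∀ n : ℕ, 1 ≤ n → S n ω ≠ S 0 ω}

/-! Let q be the return probability, γ = 1 - q, and call the maximal local time the level. When a
level is reached there is exactly one favorite site, and every further favorite of that level
appears at the current position of the walk. From there, either the walk avoids the present
favorites until another site joins them, or it hits one of them and the level rises. At high levels
the favorites are far apart, so only a return to the current site matters, and each further favorite
costs a factor close to γ. The number of favorites collected at level k is thus nearly geometric,
with P(at least i) about γ^(i-1), and Borel–Cantelli over the levels puts its records at log k /
(-log γ). Finally log k = log log n + O(1), because the level at time n lies between two multiples
of log n (`ae_eventually_level`, `ae_eventually_exp_le`).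

Separation rests on `exists_pairReturnProb_sq_le`. Two favorites of level k make 2k visits to a
pair, which costs about ρ^k with ρ < q uniformly in the pair, whereas passing level k takes a time
of order q^(-k) up to subexponential and arbitrarily small exponential corrections. Hence close
favorites have summable probabilities. Transience and the decay of hitting probabilities come from
an explicit superharmonic function.

The upper bound is the first Borel–Cantelli lemma applied to `walkLaw_favoriteState_separated_le`.
For the lower bound the levels are not independent; `walkLaw_forall_calm_succ_le` bounds the chance
of a record at level M from below given what happened at earlier levels, and the resulting product
tends to zero. Both use the Markov property at a first time (`walkLaw_stage_le`,
`le_walkLaw_stage`). -/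

/-! ### The law of the increments -/

/-- The law of one step of the simple random walk: uniform on the `2d` unit vectors. -/
noncomputable def stepLaw (d : ℕ) : Measure (Fin d → ℤ) :=
  ∑ p : Fin d × ℤˣ, (2 * (d : ENNReal))⁻¹ • Measure.dirac (Pi.single p.1 (p.2 : ℤ))

theorem isProbabilityMeasure_stepLaw {d : ℕ} (hd : d ≠ 0) : IsProbabilityMeasure (stepLaw d) := by
  constructor
  simp [stepLaw, Fintype.card_prod]
  rw [mul_comm 2, ENNReal.mul_inv_cancel] <;> simp [hd, ENNReal.mul_eq_top]

theorem stepLaw_apply {d : ℕ} (A : Set (Fin d → ℤ)) :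
    stepLaw d A = ∑ p : Fin d × ℤˣ, (2 * (d : ENNReal))⁻¹ *
      A.indicator 1 (Pi.single p.1 (p.2 : ℤ)) := by
  simp [stepLaw]

theorem injective_unitVector {d : ℕ} :
    Function.Injective (fun p : Fin d × ℤˣ => (Pi.single p.1 (p.2 : ℤ) : Fin d → ℤ)) := by
  rintro ⟨i, s⟩ ⟨j, t⟩ h
  have h1 := congrFun h i
  simp only [Pi.single_eq_same] at h1
  by_cases hij : i = j
  · subst hij
    simp only [Pi.single_eq_same] at h1
    rw [Units.val_inj.1 h1]
  · rw [Pi.single_eq_of_ne hij] at h1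
    simp at h1

/-- The only law giving mass `1 / (2d)` to each unit vector is the step law. -/
theorem eq_stepLaw {d : ℕ} (hd : d ≠ 0) (ν : Measure (Fin d → ℤ)) [IsProbabilityMeasure ν]
    (h : ∀ (i : Fin d) (s : ℤˣ), ν {Pi.single i (s : ℤ)} = (2 * (d : ENNReal))⁻¹) :
    ν = stepLaw d := by
  have := isProbabilityMeasure_stepLaw hd
  symm
  -- An inequality between probability measures is an equality, so no separate argument is needed
  -- that ν has no mass elsewhere.
  apply Measure.eq_of_le_of_isProbabilityMeasure
  rw [Measure.le_iff]
  intro A hA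
  rw [stepLaw_apply]
  classical
  let T : Finset (Fin d × ℤˣ) := Finset.univ.filter (fun p => Pi.single p.1 (p.2 : ℤ) ∈ A)
  calc _ = ∑ p ∈ T, ν {Pi.single p.1 (p.2 : ℤ)} := by
        rw [Finset.sum_filter]
        refine Finset.sum_congr rfl fun p _ => ?_
        by_cases hp : Pi.single p.1 (p.2 : ℤ) ∈ A <;> simp [hp, h]
    _ = ν (⋃ p ∈ T, {Pi.single p.1 (p.2 : ℤ)}) := by
        rw [measure_biUnion_finset]
        · intro p _ q _ hpq
          simp only [Function.onFun, Set.disjoint_singleton]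
          exact fun h => hpq (injective_unitVector h)
        · intro p _; exact MeasurableSet.singleton _
    _ ≤ ν A := by
        apply measure_mono
        simp [T]

/-- The law of the increments of the simple random walk. -/
noncomputable def walkLaw (d : ℕ) : Measure (ℕ → Fin d → ℤ) :=
  Measure.infinitePi (fun _ => stepLaw d)

/-- Reduces the theorem to a product measure on increment sequences; the starting point enters only
as a translation. -/
theorem IsSimpleRandomWalk.map_increments {Ω : Type*} [MeasurableSpace Ω] {d : ℕ} (hd : d ≠ 0)
    {S : ℕ → Ω → (Fin d → ℤ)} {μ : Measure Ω} [IsProbabilityMeasure μ]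
    (hS : IsSimpleRandomWalk S μ) :
    μ.map (fun ω n => S (n + 1) ω - S n ω) = walkLaw d := by
  have hm : ∀ n, Measurable (fun ω => S (n + 1) ω - S n ω) := fun n =>
    (hS.measurable (n + 1)).sub (hS.measurable n)
  rw [hS.indep_increments.map_fun_eq_infinitePi_map hm, walkLaw]
  congr 1
  ext1 n
  have : IsProbabilityMeasure (μ.map (fun ω => S (n + 1) ω - S n ω)) :=
    Measure.isProbabilityMeasure_map (hm n).aemeasurable
  apply eq_stepLaw hd
  intro i s
  rw [Measure.map_apply (hm n) (MeasurableSet.singleton _)]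
  exact hS.step n i s

/-! ### The Markov property at a fixed time -/

/-- The shift of a sequence of increments. -/
def shift {α : Type*} (t : ℕ) (x : ℕ → α) : ℕ → α := fun n => x (t + n)

@[fun_prop]
theorem measurable_shift {α : Type*} [MeasurableSpace α] (t : ℕ) :
    Measurable (shift (α := α) t) := by
  unfold shift; fun_prop

/-- The sequences that agree with `u` before time `t`. -/
def prefixSet {α : Type*} (t : ℕ) (u : ℕ → α) : Set (ℕ → α) := {x | ∀ i < t, x i = u i}

theorem measurableSet_prefixSet {α : Type*} [MeasurableSpace α] [MeasurableSingletonClass α]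
    (t : ℕ) (u : ℕ → α) : MeasurableSet (prefixSet t u) := by
  have : prefixSet t u = ⋂ i ∈ Finset.range t, (fun x => x i) ⁻¹' {u i} := by
    ext x; simp [prefixSet]
  rw [this]
  exact Finset.measurableSet_biInter _ fun i _ => measurable_pi_apply i (MeasurableSet.singleton _)

/-- Conditionally on a prefix of positive probability, the shifted sequence satisfies the identities
on boxes that characterize the product measure. -/
theorem measure_prefixSet_inter_shift {α : Type*} [MeasurableSpace α] [MeasurableSingletonClass α]
    (ρ : Measure α) [IsProbabilityMeasure ρ] (t : ℕ) (u : ℕ → α) {Q : Set (ℕ → α)}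
    (hQ : MeasurableSet Q) :
    Measure.infinitePi (fun _ => ρ) (prefixSet t u ∩ shift t ⁻¹' Q) =
      Measure.infinitePi (fun _ => ρ) (prefixSet t u) * Measure.infinitePi (fun _ => ρ) Q := by
  set P := Measure.infinitePi (fun _ : ℕ => ρ) with hP
  have hA := measurableSet_prefixSet t u
  set A := prefixSet t u with hAdef
  by_cases h0 : P A = 0
  · rw [h0, zero_mul]
    exact measure_mono_null Set.inter_subset_left h0
  have hA' : P A = ∏ i ∈ Finset.range t, ρ {u i} := by
    have : A = Set.pi (Finset.range t : Finset ℕ) (fun i => {u i}) := by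
      ext x; simp [hAdef, prefixSet]
    rw [this, hP, Measure.infinitePi_pi]
    intro i _; exact MeasurableSet.singleton _
  have key : (P A)⁻¹ • (P.restrict A).map (shift t) = P := by
    rw [hP]
    apply Measure.eq_infinitePi
    intro s (B : ℕ → Set α) hB
    have hpi : MeasurableSet (Set.pi (s : Set ℕ) B) :=
      MeasurableSet.pi s.countable_toSet (fun i _ => hB i)
    rw [Measure.smul_apply, Measure.map_apply (measurable_shift t) hpi,
      Measure.restrict_apply (measurable_shift t hpi)]
    have hset : shift t ⁻¹' (Set.pi (s : Set ℕ) B) ∩ A =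
        Set.pi ((Finset.range t ∪ s.map (addLeftEmbedding t) : Finset ℕ) : Set ℕ)
          (fun i => if i < t then {u i} else B (i - t)) := by
      ext x
      simp only [Set.mem_inter_iff, Set.mem_preimage, Set.mem_pi, Finset.mem_coe, hAdef, prefixSet,
        Finset.mem_union, Finset.mem_range, Finset.mem_map, addLeftEmbedding_apply]
      constructor
      · rintro ⟨h1, h2⟩ i hi
        rcases hi with hi | ⟨j, hj, rfl⟩
        · simp [hi, h2 i hi]
        · simpa [shift, Nat.add_sub_cancel_left] using h1 j hj
      · intro h
        refine ⟨fun i hi => ?_, fun i hi => ?_⟩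
        · simpa [shift, Nat.add_sub_cancel_left] using h (t + i) (Or.inr ⟨i, hi, rfl⟩)
        · simpa [hi] using h i (Or.inl hi)
    rw [hset, Measure.infinitePi_pi, Finset.prod_union]
    · rw [Finset.prod_map]
      have e1 : ∏ x ∈ Finset.range t, ρ (if x < t then {u x} else B (x - t)) = P A := by
        rw [hA']
        exact Finset.prod_congr rfl fun i hi => by rw [if_pos (Finset.mem_range.1 hi)]
      rw [e1]
      simp only [addLeftEmbedding_apply, not_lt, le_add_iff_nonneg_right, zero_le, if_neg,
        Nat.add_sub_cancel_left, smul_eq_mul]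
      rw [← mul_assoc, ENNReal.inv_mul_cancel h0 (measure_ne_top _ _), one_mul]
    · rw [Finset.disjoint_left]
      intro i hi
      simp only [Finset.mem_map, addLeftEmbedding_apply, not_exists, not_and]
      have := Finset.mem_range.1 hi
      intro j _; omega
    · intro i _
      split_ifs
      · exact MeasurableSet.singleton _
      · exact hB _
  have h := congrArg (fun ν => ν Q) key
  simp only [Measure.smul_apply, Measure.map_apply (measurable_shift t) hQ,
      Measure.restrict_apply (measurable_shift t hQ), smul_eq_mul] at h
  rw [Set.inter_comm, ← h, ← mul_assoc, ENNReal.mul_inv_cancel h0 (measure_ne_top _ _), one_mul]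

theorem walkLaw_map_neg {d : ℕ} (hd : d ≠ 0) :
    (walkLaw d).map (fun x n => - x n) = walkLaw d := by
  have := isProbabilityMeasure_stepLaw hd
  rw [walkLaw, Measure.infinitePi_map_pi (f := fun _ v => - v) _ (fun _ => measurable_neg)]
  congr 1
  ext1 n
  have : IsProbabilityMeasure ((stepLaw d).map (fun v => - v)) :=
    Measure.isProbabilityMeasure_map measurable_neg.aemeasurable
  apply eq_stepLaw hd
  intro i s
  rw [Measure.map_apply measurable_neg (MeasurableSet.singleton _), stepLaw_apply]
  rw [Finset.sum_eq_single (i, -s)]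
  · rw [Set.indicator_of_mem]
    · simp
    · simp [Pi.single_neg]
  · rintro ⟨j, t⟩ _ hne
    rw [Set.indicator_of_notMem, mul_zero]
    intro hmem
    apply hne
    apply injective_unitVector
    simp only [Set.mem_preimage, Set.mem_singleton_iff] at hmem
    simp [Pi.single_neg, ← hmem]
  · simp

instance {d : ℕ} [NeZero d] : IsProbabilityMeasure (stepLaw d) :=
  isProbabilityMeasure_stepLaw (NeZero.ne d)

instance {d : ℕ} [NeZero d] : IsProbabilityMeasure (walkLaw d) := by
  unfold walkLaw; infer_instance

/-- Over a countable alphabet there are countably many prefixes of length t, so dependence on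
finitely many coordinates already gives measurability. -/
theorem DependsOn.measurableSet_setOf {α : Type*} [MeasurableSpace α] [Countable α]
    [MeasurableSingletonClass α] {t : ℕ} {σ : (ℕ → α) → Prop} (h : DependsOn σ (Set.Iio t)) :
    MeasurableSet {x | σ x} := by
  let r : (ℕ → α) → (Fin t → α) := fun x i => x i
  have hr : Measurable r := by fun_prop
  have : {x | σ x} = r ⁻¹' (r '' {x | σ x}) := by
    ext x
    constructor
    · intro hx; exact ⟨x, hx, rfl⟩
    · rintro ⟨y, hy, hxy⟩
      have : σ y = σ x := h fun i hi => congrFun hxy ⟨i, hi⟩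
      exact this.mp hy
  rw [this]
  exact hr (Set.to_countable _).measurableSet

/-- The sequence with prescribed first `t` terms, extended by zeros. -/
def extendPrefix {d t : ℕ} (v : Fin t → Fin d → ℤ) : ℕ → Fin d → ℤ :=
  fun n => if h : n < t then v ⟨n, h⟩ else 0

/-- The target `Q` for the future may depend on the past; summing over the countably many prefixes
replaces conditional expectations. -/
theorem walkLaw_and_shift_mem {d : ℕ} [NeZero d] {t : ℕ} {σ : (ℕ → Fin d → ℤ) → Prop}
    {Q : (ℕ → Fin d → ℤ) → Set (ℕ → Fin d → ℤ)} (hσ : DependsOn σ (Set.Iio t))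
    (hQ : DependsOn Q (Set.Iio t)) (hQm : ∀ x, MeasurableSet (Q x)) :
    walkLaw d {x | σ x ∧ shift t x ∈ Q x} =
      ∑' v : Fin t → Fin d → ℤ, {v | σ (extendPrefix v)}.indicator
        (fun v => walkLaw d (prefixSet t (extendPrefix v)) * walkLaw d (Q (extendPrefix v))) v := by
  have hpre : ∀ (v : Fin t → Fin d → ℤ) x, x ∈ prefixSet t (extendPrefix v) →
      ∀ i ∈ Set.Iio t, x i = extendPrefix v i := fun v x hx i hi => hx i hi
  let E : (Fin t → Fin d → ℤ) → Set (ℕ → Fin d → ℤ) := fun v =>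
    {x | σ (extendPrefix v)} ∩ (prefixSet t (extendPrefix v) ∩ shift t ⁻¹' Q (extendPrefix v))
  have hE : {x | σ x ∧ shift t x ∈ Q x} = ⋃ v, E v := by
    ext x
    simp only [Set.mem_iUnion, E, Set.mem_inter_iff, Set.mem_preimage]
    constructor
    · rintro ⟨h1, h2⟩
      have hx : x ∈ prefixSet t (extendPrefix (fun i : Fin t => x i)) := by
        intro i hi; simp [extendPrefix, hi]
      refine ⟨fun i => x i, ?_, hx, ?_⟩
      · exact (hσ (hpre _ _ hx)) ▸ h1
      · exact (hQ (hpre _ _ hx)) ▸ h2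
    · rintro ⟨v, h1, h2, h3⟩
      refine ⟨?_, ?_⟩
      · exact (hσ (hpre _ _ h2)).symm ▸ h1
      · exact (hQ (hpre _ _ h2)).symm ▸ h3
  rw [hE, measure_iUnion]
  · refine tsum_congr fun v => ?_
    by_cases hv : σ (extendPrefix v)
    · rw [Set.indicator_of_mem (by exact hv)]
      have : E v = prefixSet t (extendPrefix v) ∩ shift t ⁻¹' Q (extendPrefix v) := by
        simp [E, hv]
      rw [this]
      exact measure_prefixSet_inter_shift _ _ _ (hQm _)
    · rw [Set.indicator_of_notMem (by exact hv)]
      simp [E, hv]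
  · intro v w hvw
    rw [Function.onFun, Set.disjoint_left]
    rintro x ⟨_, hx, _⟩ ⟨_, hx', _⟩
    apply hvw
    ext i : 1
    have h1 := hx i i.2
    have h2 := hx' i i.2
    simp only [extendPrefix, i.2, dite_true] at h1 h2
    rw [← h1, ← h2]
  · intro v
    exact (MeasurableSet.const _).inter
      ((measurableSet_prefixSet _ _).inter (measurable_shift t (hQm _)))

theorem walkLaw_setOf_eq_tsum {d : ℕ} [NeZero d] {t : ℕ} {σ : (ℕ → Fin d → ℤ) → Prop}
    (hσ : DependsOn σ (Set.Iio t)) :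
    walkLaw d {x | σ x} = ∑' v : Fin t → Fin d → ℤ, {v | σ (extendPrefix v)}.indicator
        (fun v => walkLaw d (prefixSet t (extendPrefix v))) v := by
  have := walkLaw_and_shift_mem (Q := fun _ => Set.univ) hσ (fun _ _ _ => rfl)
    (fun _ => MeasurableSet.univ)
  simpa using this

theorem walkLaw_and_shift_mem_le {d : ℕ} [NeZero d] {t : ℕ} {σ : (ℕ → Fin d → ℤ) → Prop}
    {Q : (ℕ → Fin d → ℤ) → Set (ℕ → Fin d → ℤ)} (hσ : DependsOn σ (Set.Iio t))
    (hQ : DependsOn Q (Set.Iio t)) (hQm : ∀ x, MeasurableSet (Q x)) {p : ENNReal}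
    (hp : ∀ x, σ x → walkLaw d (Q x) ≤ p) :
    walkLaw d {x | σ x ∧ shift t x ∈ Q x} ≤ p * walkLaw d {x | σ x} := by
  rw [walkLaw_and_shift_mem hσ hQ hQm, walkLaw_setOf_eq_tsum hσ, ← ENNReal.tsum_mul_left]
  refine ENNReal.tsum_le_tsum fun v => ?_
  by_cases hv : σ (extendPrefix v)
  · rw [Set.indicator_of_mem (by exact hv), Set.indicator_of_mem (by exact hv), mul_comm]
    gcongr
    exact hp _ hv
  · rw [Set.indicator_of_notMem (by exact hv)]
    simp

theorem le_walkLaw_and_shift_mem {d : ℕ} [NeZero d] {t : ℕ} {σ : (ℕ → Fin d → ℤ) → Prop}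
    {Q : (ℕ → Fin d → ℤ) → Set (ℕ → Fin d → ℤ)} (hσ : DependsOn σ (Set.Iio t))
    (hQ : DependsOn Q (Set.Iio t)) (hQm : ∀ x, MeasurableSet (Q x)) {p : ENNReal}
    (hp : ∀ x, σ x → p ≤ walkLaw d (Q x)) :
    p * walkLaw d {x | σ x} ≤ walkLaw d {x | σ x ∧ shift t x ∈ Q x} := by
  rw [walkLaw_and_shift_mem hσ hQ hQm, walkLaw_setOf_eq_tsum hσ, ← ENNReal.tsum_mul_left]
  refine ENNReal.tsum_le_tsum fun v => ?_
  by_cases hv : σ (extendPrefix v)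
  · rw [Set.indicator_of_mem (by exact hv), Set.indicator_of_mem (by exact hv), mul_comm]
    gcongr
    exact hp _ hv
  · rw [Set.indicator_of_notMem (by exact hv)]
    simp

/-! ### The Markov property at a first time, and at the first step -/

/-- `t` is the first time at which `τ` holds. -/
def FirstAt {α : Type*} (τ : ℕ → α → Prop) (t : ℕ) (x : α) : Prop :=
  τ t x ∧ ∀ s < t, ¬ τ s x

theorem exists_firstAt {α : Type*} {τ : ℕ → α → Prop} {x : α} (h : ∃ t, τ t x) :
    ∃ t, FirstAt τ t x := by
  classical
  exact ⟨Nat.find h, Nat.find_spec h, fun s hs => Nat.find_min h hs⟩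

theorem FirstAt.unique {α : Type*} {τ : ℕ → α → Prop} {x : α} {s t : ℕ} (hs : FirstAt τ s x)
    (ht : FirstAt τ t x) : s = t := by
  rcases lt_trichotomy s t with h | h | h
  · exact absurd hs.1 (ht.2 s h)
  · exact h
  · exact absurd ht.1 (hs.2 t h)

theorem dependsOn_firstAt {α : Type*} {τ : ℕ → (ℕ → α) → Prop}
    (hτ : ∀ t, DependsOn (τ t) (Set.Iio t)) (t : ℕ) : DependsOn (FirstAt τ t) (Set.Iio t) := by
  intro x y hxy
  have h : ∀ s ≤ t, τ s x = τ s y := fun s hs =>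
    hτ s fun i hi => hxy i (lt_of_lt_of_le hi hs)
  unfold FirstAt
  rw [h t le_rfl]
  congr 1
  refine forall_congr fun s => ?_
  refine propext ⟨fun H hs => h s hs.le ▸ H hs, fun H hs => (h s hs.le).symm ▸ H hs⟩

theorem measurableSet_exists_of_dependsOn {α : Type*} [MeasurableSpace α] [Countable α]
    [MeasurableSingletonClass α] {τ : ℕ → (ℕ → α) → Prop}
    (hτ : ∀ t, ∃ s, DependsOn (τ t) (Set.Iio s)) : MeasurableSet {x | ∃ t, τ t x} := by
  have : {x | ∃ t, τ t x} = ⋃ t, {x | τ t x} := by ext; simp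
  rw [this]
  exact MeasurableSet.iUnion fun t => (hτ t).choose_spec.measurableSet_setOf

section Stage

variable {d : ℕ} {τ : ℕ → (ℕ → Fin d → ℤ) → Prop}
  {Q : ℕ → (ℕ → Fin d → ℤ) → Set (ℕ → Fin d → ℤ)}

theorem walkLaw_exists_firstAt (hτ : ∀ t, DependsOn (τ t) (Set.Iio t))
    (hQ : ∀ t, DependsOn (Q t) (Set.Iio t)) (hQm : ∀ t x, MeasurableSet (Q t x)) :
    walkLaw d {x | ∃ t, FirstAt τ t x ∧ shift t x ∈ Q t x} =
      ∑' t, walkLaw d {x | FirstAt τ t x ∧ shift t x ∈ Q t x} := by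
  have : {x | ∃ t, FirstAt τ t x ∧ shift t x ∈ Q t x} =
      ⋃ t, {x | FirstAt τ t x ∧ shift t x ∈ Q t x} := by ext; simp
  rw [this, measure_iUnion]
  · intro s t hst
    rw [Function.onFun, Set.disjoint_left]
    rintro x hx hx'
    exact hst (hx.1.unique hx'.1)
  · intro t
    classical
    have hE : {x | FirstAt τ t x ∧ shift t x ∈ Q t x} =
        ⋃ v : Fin t → Fin d → ℤ, {x | FirstAt τ t x} ∩
          (prefixSet t (extendPrefix v) ∩ shift t ⁻¹' Q t (extendPrefix v)) := by
      ext x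
      simp only [Set.mem_iUnion, Set.mem_inter_iff, Set.mem_preimage]
      constructor
      · rintro ⟨h1, h2⟩
        have hx : x ∈ prefixSet t (extendPrefix (fun i : Fin t => x i)) := by
          intro i hi; simp [extendPrefix, hi]
        exact ⟨fun i => x i, h1, hx, (hQ t fun i hi => hx i hi) ▸ h2⟩
      · rintro ⟨v, h1, h2, h3⟩
        exact ⟨h1, (hQ t fun i hi => h2 i hi).symm ▸ h3⟩
    rw [hE]
    exact MeasurableSet.iUnion fun v => (dependsOn_firstAt hτ t).measurableSet_setOf.inter
      ((measurableSet_prefixSet _ _).inter (measurable_shift t (hQm _ _)))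

theorem walkLaw_exists_eq_tsum_firstAt [NeZero d] (hτ : ∀ t, DependsOn (τ t) (Set.Iio t)) :
    walkLaw d {x | ∃ t, τ t x} = ∑' t, walkLaw d {x | FirstAt τ t x} := by
  have := walkLaw_exists_firstAt (Q := fun _ _ => Set.univ) hτ (fun _ _ _ _ => rfl)
    (fun _ _ => MeasurableSet.univ)
  simp only [Set.mem_univ, and_true] at this
  rw [← this]
  congr 1
  ext x
  exact ⟨exists_firstAt, fun ⟨t, ht⟩ => ⟨t, ht.1⟩⟩

/-- If, at the first time when `τ` holds, the future has probability at most `p` to lie in the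
set `Q`, then this happens with probability at most `p` times the probability that `τ` ever
holds. -/
theorem walkLaw_stage_le [NeZero d] (hτ : ∀ t, DependsOn (τ t) (Set.Iio t))
    (hQ : ∀ t, DependsOn (Q t) (Set.Iio t)) (hQm : ∀ t x, MeasurableSet (Q t x)) {p : ℝ}
    (hp0 : 0 ≤ p) (hp : ∀ t x, FirstAt τ t x → (walkLaw d).real (Q t x) ≤ p) :
    (walkLaw d).real {x | ∃ t, FirstAt τ t x ∧ shift t x ∈ Q t x} ≤
      p * (walkLaw d).real {x | ∃ t, τ t x} := by
  have key : walkLaw d {x | ∃ t, FirstAt τ t x ∧ shift t x ∈ Q t x} ≤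
      ENNReal.ofReal p * walkLaw d {x | ∃ t, τ t x} := by
    rw [walkLaw_exists_firstAt hτ hQ hQm, walkLaw_exists_eq_tsum_firstAt hτ,
      ← ENNReal.tsum_mul_left]
    refine ENNReal.tsum_le_tsum fun t => ?_
    refine walkLaw_and_shift_mem_le (dependsOn_firstAt hτ t) (hQ t) (hQm t) fun x hx => ?_
    exact ENNReal.le_ofReal_iff_toReal_le (measure_ne_top _ _) hp0 |>.2 (hp t x hx)
  have := ENNReal.toReal_mono (by finiteness) key
  simpa [Measure.real, ENNReal.toReal_mul, hp0] using this

/-- If, at the first time when `τ` holds, the future has probability at least `p` to lie in the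
set `Q`, then this happens with probability at least `p` times the probability that `τ` ever
holds. -/
theorem le_walkLaw_stage [NeZero d] (hτ : ∀ t, DependsOn (τ t) (Set.Iio t))
    (hQ : ∀ t, DependsOn (Q t) (Set.Iio t)) (hQm : ∀ t x, MeasurableSet (Q t x)) {p : ℝ}
    (hp0 : 0 ≤ p) (hp : ∀ t x, FirstAt τ t x → p ≤ (walkLaw d).real (Q t x)) :
    p * (walkLaw d).real {x | ∃ t, τ t x} ≤
      (walkLaw d).real {x | ∃ t, FirstAt τ t x ∧ shift t x ∈ Q t x} := by
  have key : ENNReal.ofReal p * walkLaw d {x | ∃ t, τ t x} ≤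
      walkLaw d {x | ∃ t, FirstAt τ t x ∧ shift t x ∈ Q t x} := by
    rw [walkLaw_exists_firstAt hτ hQ hQm, walkLaw_exists_eq_tsum_firstAt hτ,
      ← ENNReal.tsum_mul_left]
    refine ENNReal.tsum_le_tsum fun t => ?_
    refine le_walkLaw_and_shift_mem (dependsOn_firstAt hτ t) (hQ t) (hQm t) fun x hx => ?_
    exact ENNReal.ofReal_le_iff_le_toReal (measure_ne_top _ _) |>.2 (hp t x hx)
  have := ENNReal.toReal_mono (by finiteness) key
  simpa [Measure.real, ENNReal.toReal_mul, hp0] using this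

end Stage

theorem walkLaw_real_and_shift_mem_le {d : ℕ} [NeZero d] {t : ℕ} {σ : (ℕ → Fin d → ℤ) → Prop}
    {Q : Set (ℕ → Fin d → ℤ)} (hσ : DependsOn σ (Set.Iio t)) (hQm : MeasurableSet Q) :
    (walkLaw d).real {x | σ x ∧ shift t x ∈ Q} ≤
      (walkLaw d).real Q * (walkLaw d).real {x | σ x} := by
  have key := walkLaw_and_shift_mem_le (Q := fun _ => Q) hσ (fun _ _ _ => rfl) (fun _ => hQm)
    (fun _ _ => le_rfl)
  have := ENNReal.toReal_mono (by finiteness) key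
  simpa [Measure.real, ENNReal.toReal_mul] using this

theorem walkLaw_prefix_one {d : ℕ} [NeZero d] (i : Fin d) (s : ℤˣ) :
    walkLaw d {x | x 0 = Pi.single i (s : ℤ)} = (2 * (d : ENNReal))⁻¹ := by
  have h : {x : ℕ → Fin d → ℤ | x 0 = Pi.single i (s : ℤ)} =
      Set.pi (({0} : Finset ℕ) : Set ℕ) (fun _ => {Pi.single i (s : ℤ)}) := by
    ext x; simp
  rw [h, walkLaw, Measure.infinitePi_pi _ (fun _ _ => MeasurableSet.singleton _)]
  simp only [Finset.prod_singleton]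
  rw [stepLaw_apply, Finset.sum_eq_single (i, s)]
  · simp
  · rintro p _ hne
    rw [Set.indicator_of_notMem, mul_zero]
    exact fun hmem => hne (injective_unitVector hmem)
  · simp

theorem ae_exists_unit_step {d : ℕ} [NeZero d] :
    ∀ᵐ x ∂(walkLaw d), ∀ n, ∃ (i : Fin d) (s : ℤˣ), x n = Pi.single i (s : ℤ) := by
  rw [ae_all_iff]
  intro n
  have h1 : ∀ᵐ v ∂(stepLaw d), ∃ (i : Fin d) (s : ℤˣ), v = Pi.single i (s : ℤ) := by
    rw [ae_iff, stepLaw_apply]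
    refine Finset.sum_eq_zero fun p _ => ?_
    rw [Set.indicator_of_notMem, mul_zero]
    simp only [Set.mem_ofPred_eq, not_not]
    exact ⟨p.1, p.2, rfl⟩
  have h2 := measurePreserving_eval_infinitePi (fun _ : ℕ => stepLaw d) n
  exact h2.quasiMeasurePreserving.ae h1

/-- Conditioning on the first step. -/
theorem walkLaw_first_step {d : ℕ} [NeZero d] {Q : (Fin d → ℤ) → Set (ℕ → Fin d → ℤ)}
    (hQm : ∀ e, MeasurableSet (Q e)) :
    (walkLaw d).real {x | shift 1 x ∈ Q (x 0)} =
      (2 * (d : ℝ))⁻¹ * ∑ p : Fin d × ℤˣ, (walkLaw d).real (Q (Pi.single p.1 (p.2 : ℤ))) := by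
  let E : Fin d × ℤˣ → Set (ℕ → Fin d → ℤ) := fun p =>
    {x | x 0 = Pi.single p.1 (p.2 : ℤ)} ∩ shift 1 ⁻¹' Q (Pi.single p.1 (p.2 : ℤ))
  have hpre : ∀ p : Fin d × ℤˣ, {x : ℕ → Fin d → ℤ | x 0 = Pi.single p.1 (p.2 : ℤ)} =
      prefixSet 1 (fun _ => Pi.single p.1 (p.2 : ℤ)) := by
    intro p; ext x; simp [prefixSet]
  have hEm : ∀ p, MeasurableSet (E p) := fun p => by
    simp only [E, hpre]
    exact (measurableSet_prefixSet _ _).inter (measurable_shift 1 (hQm _))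
  have hE : (walkLaw d).real {x | shift 1 x ∈ Q (x 0)} = (walkLaw d).real (⋃ p ∈ Finset.univ, E p) := by
    apply measureReal_congr
    filter_upwards [ae_exists_unit_step (d := d)] with x hx
    obtain ⟨i, s, h⟩ := hx 0
    apply propext
    constructor
    · intro hx
      refine Set.mem_biUnion (Finset.mem_coe.2 (Finset.mem_univ (i, s))) ⟨h, ?_⟩
      change shift 1 x ∈ Q (x 0) at hx
      rw [h] at hx
      exact hx
    · intro hx
      obtain ⟨p, _, h1, h2⟩ := Set.mem_iUnion₂.1 hx
      change shift 1 x ∈ Q (x 0)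
      rw [h1]
      exact h2
  rw [hE, measureReal_biUnion_finset, Finset.mul_sum]
  · refine Finset.sum_congr rfl fun p _ => ?_
    have h1 : walkLaw d (E p) = (2 * (d : ENNReal))⁻¹ * walkLaw d (Q (Pi.single p.1 (p.2 : ℤ))) := by
      rw [← walkLaw_prefix_one p.1 p.2]
      simp only [E, hpre]
      exact measure_prefixSet_inter_shift _ _ _ (hQm _)
    simp [Measure.real, h1, ENNReal.toReal_mul]
  · intro p _ q _ hpq
    rw [Function.onFun, Set.disjoint_left]
    rintro x ⟨h1, _⟩ ⟨h2, _⟩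
    exact hpq (injective_unitVector ((show x 0 = _ from h1).symm.trans h2))
  · intro p _; exact hEm p

/-! ### Partial sums of the increments -/

/-- The walk started at the origin with increments `x`. -/
def walk {d : ℕ} (x : ℕ → Fin d → ℤ) (n : ℕ) : Fin d → ℤ := ∑ i ∈ Finset.range n, x i

@[simp] theorem walk_zero {d : ℕ} (x : ℕ → Fin d → ℤ) : walk x 0 = 0 := by simp [walk]

theorem walk_succ {d : ℕ} (x : ℕ → Fin d → ℤ) (n : ℕ) : walk x (n + 1) = walk x n + x n :=
  Finset.sum_range_succ _ _

theorem walk_add {d : ℕ} (x : ℕ → Fin d → ℤ) (t n : ℕ) :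
    walk x (t + n) = walk x t + walk (shift t x) n := by
  simp [walk, Finset.sum_range_add, shift]

theorem walk_neg {d : ℕ} (x : ℕ → Fin d → ℤ) (n : ℕ) :
    walk (fun i => - x i) n = - walk x n := by
  simp [walk]

theorem walk_congr {d n : ℕ} {x y : ℕ → Fin d → ℤ} (h : ∀ i ∈ Set.Iio n, x i = y i) {m : ℕ}
    (hm : m ≤ n) : walk x m = walk y m := by
  refine Finset.sum_congr rfl fun i hi => h i ?_
  have := Finset.mem_range.1 hi
  exact lt_of_lt_of_le this hm

theorem dependsOn_of_walk {d : ℕ} {β : Type*} (n : ℕ) {F : (ℕ → Fin d → ℤ) → β}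
    (h : ∀ w w' : ℕ → Fin d → ℤ, (∀ m ≤ n, w m = w' m) → F w = F w') :
    DependsOn (fun x => F (walk x)) (Set.Iio n) :=
  fun _ _ hxy => h _ _ fun _ hm => walk_congr hxy hm

theorem measurableSet_walk {d : ℕ} (n : ℕ) {F : (ℕ → Fin d → ℤ) → Prop}
    (h : ∀ w w' : ℕ → Fin d → ℤ, (∀ m ≤ n, w m = w' m) → F w = F w') :
    MeasurableSet {x | F (walk x)} := (dependsOn_of_walk n h).measurableSet_setOf

/-! ### Transience from a superharmonic function -/

/-- The function `z ↦ (|z|² + 1000)^(-1/4)`, superharmonic for the simple random walk in dimension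
at least three. -/
noncomputable def superharm {d : ℕ} (z : Fin d → ℤ) : ℝ :=
  ((∑ i, (z i : ℝ) ^ 2) + 1000) ^ (-(1 / 4) : ℝ)

theorem superharm_pos {d : ℕ} (z : Fin d → ℤ) : 0 < superharm z := by
  unfold superharm
  have : 0 ≤ ∑ i, (z i : ℝ) ^ 2 := Finset.sum_nonneg fun i _ => sq_nonneg _
  positivity

/-- The Taylor coefficient of s² is 5/32; the slack up to 3/16 absorbs the remainder for these s.
Taking fourth powers turns the claim into a polynomial inequality. -/
theorem one_add_rpow_neg_quarter_le {s : ℝ} (hs : |s| ≤ 1 / 20) :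
    (1 + s) ^ (-(1 / 4) : ℝ) ≤ 1 - s / 4 + 3 / 16 * s ^ 2 := by
  obtain ⟨h1, h2⟩ := abs_le.1 hs
  have hy : 0 < 1 - s / 4 + 3 / 16 * s ^ 2 := by nlinarith
  have h0 : 0 < 1 + s := by linarith
  have key : 1 ≤ (1 + s) * (1 - s / 4 + 3 / 16 * s ^ 2) ^ 4 := by
    have hv : 1 + 4 * (- s / 4 + 3 / 16 * s ^ 2) + 6 * (- s / 4 + 3 / 16 * s ^ 2) ^ 2
        + 4 * (- s / 4 + 3 / 16 * s ^ 2) ^ 3 ≤ (1 - s / 4 + 3 / 16 * s ^ 2) ^ 4 := by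
      have := sq_nonneg ((- s / 4 + 3 / 16 * s ^ 2) ^ 2)
      nlinarith
    refine le_trans ?_ (mul_le_mul_of_nonneg_left hv h0.le)
    have e : (1 + s) * (1 + 4 * (- s / 4 + 3 / 16 * s ^ 2) + 6 * (- s / 4 + 3 / 16 * s ^ 2) ^ 2
        + 4 * (- s / 4 + 3 / 16 * s ^ 2) ^ 3) - 1 = s ^ 2 * (1 / 8 + s / 2 - 35 / 128 * s ^ 2
        + 63 / 256 * s ^ 3 - 81 / 1024 * s ^ 4 + 27 / 1024 * s ^ 5) := by ring
    have hs2 : s ^ 2 ≤ 1 / 400 := by nlinarith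
    have hs3 : -(1 / 400) ≤ s ^ 3 := by nlinarith [sq_nonneg s]
    have hs4 : s ^ 4 ≤ 1 / 400 := by nlinarith [sq_nonneg s]
    have hs5 : -(1 / 400) ≤ s ^ 5 := by nlinarith [sq_nonneg s, sq_nonneg (s ^ 2)]
    have : 0 ≤ s ^ 2 * (1 / 8 + s / 2 - 35 / 128 * s ^ 2
        + 63 / 256 * s ^ 3 - 81 / 1024 * s ^ 4 + 27 / 1024 * s ^ 5) :=
      mul_nonneg (sq_nonneg s) (by linarith)
    linarith
  have : ((1 + s) ^ (-(1 / 4) : ℝ)) ^ 4 ≤ (1 - s / 4 + 3 / 16 * s ^ 2) ^ 4 := by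
    rw [← Real.rpow_natCast, ← Real.rpow_mul h0.le]
    norm_num
    rw [Real.rpow_neg_one, inv_le_iff_one_le_mul₀ h0]
    linarith
  exact le_of_pow_le_pow_left₀ (by norm_num) hy.le this

theorem sum_sq_add_unit {d : ℕ} (z : Fin d → ℤ) (i : Fin d) (s : ℤˣ) :
    ∑ j, (((z + Pi.single i (s : ℤ) : Fin d → ℤ) j : ℤ) : ℝ) ^ 2 =
      ∑ j, (z j : ℝ) ^ 2 + (1 + 2 * ((s : ℤ) : ℝ) * z i) := by
  have h1 : ∀ j, (((z + Pi.single i (s : ℤ) : Fin d → ℤ) j : ℤ) : ℝ) ^ 2 =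
      (z j : ℝ) ^ 2 + if j = i then (1 + 2 * ((s : ℤ) : ℝ) * z i) else 0 := by
    intro j
    have hs : ((s : ℤ) : ℝ) ^ 2 = 1 := by
      rcases Int.units_eq_one_or s with rfl | rfl <;> norm_num
    by_cases hj : j = i
    · subst hj
      simp
      linear_combination hs
    · simp [hj]
  rw [Finset.sum_congr rfl fun j _ => h1 j, Finset.sum_add_distrib]
  simp

theorem superharm_add_unit_le {d : ℕ} (z : Fin d → ℤ) (i : Fin d) (s : ℤˣ) :
    superharm (z + Pi.single i (s : ℤ)) ≤ superharm z *
      (1 - (1 + 2 * ((s : ℤ) : ℝ) * z i) / ((∑ j, (z j : ℝ) ^ 2) + 1000) / 4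
        + 3 / 16 * ((1 + 2 * ((s : ℤ) : ℝ) * z i) / ((∑ j, (z j : ℝ) ^ 2) + 1000)) ^ 2) := by
  unfold superharm
  rw [sum_sq_add_unit]
  set N := ∑ j, (z j : ℝ) ^ 2 with hN
  have hN0 : 0 ≤ N := Finset.sum_nonneg fun i _ => sq_nonneg _
  have hzN : (z i : ℝ) ^ 2 ≤ N :=
    Finset.single_le_sum (f := fun j => (z j : ℝ) ^ 2) (fun j _ => sq_nonneg _) (Finset.mem_univ i)
  set b := 1 + 2 * ((s : ℤ) : ℝ) * z i with hb
  have hu : 0 < N + 1000 := by linarith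
  -- The shift by 1000 keeps the relative change of |z|² + 1000 in one step this small, even near
  -- the origin.
  have hbabs : |b / (N + 1000)| ≤ 1 / 20 := by
    rw [abs_div, abs_of_pos hu, div_le_iff₀ hu, abs_le]
    rcases Int.units_eq_one_or s with rfl | rfl <;> simp only [hb] <;> push_cast <;>
      constructor <;> nlinarith [sq_nonneg ((z i : ℝ) - 20), sq_nonneg ((z i : ℝ) + 20)]
  have hpos : 0 < 1 + b / (N + 1000) := by linarith [(abs_le.1 hbabs).1]
  have e : N + b + 1000 = (N + 1000) * (1 + b / (N + 1000)) := by field_simp; ring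
  rw [e, Real.mul_rpow hu.le hpos.le]
  gcongr
  exact one_add_rpow_neg_quarter_le hbabs

theorem sum_superharm_le {d : ℕ} (hd : 3 ≤ d) (z : Fin d → ℤ) :
    ∑ p : Fin d × ℤˣ, superharm (z + Pi.single p.1 (p.2 : ℤ)) ≤ 2 * d * superharm z := by
  refine (Finset.sum_le_sum fun p _ => superharm_add_unit_le z p.1 p.2).trans ?_
  rw [← Finset.mul_sum, mul_comm]
  refine mul_le_mul_of_nonneg_right ?_ (superharm_pos z).le
  rw [Fintype.sum_prod_type]
  set N := ∑ j, (z j : ℝ) ^ 2 with hN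
  have hN0 : 0 ≤ N := Finset.sum_nonneg fun i _ => sq_nonneg _
  have hu : 0 < N + 1000 := by linarith
  have h1 : ∀ i : Fin d, ∑ s : ℤˣ, (1 - (1 + 2 * ((s : ℤ) : ℝ) * z i) / (N + 1000) / 4
        + 3 / 16 * ((1 + 2 * ((s : ℤ) : ℝ) * z i) / (N + 1000)) ^ 2) =
      2 - 1 / (2 * (N + 1000)) + 3 / 8 / (N + 1000) ^ 2
        + 3 / 2 / (N + 1000) ^ 2 * (z i : ℝ) ^ 2 := by
    intro i
    rw [UnitsInt.univ, Finset.sum_pair (by decide)]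
    push_cast
    field_simp
    ring
  rw [Finset.sum_congr rfl fun i _ => h1 i, Finset.sum_add_distrib, ← Finset.mul_sum, ← hN]
  simp only [Finset.sum_const, Finset.card_univ, Fintype.card_fin, nsmul_eq_mul]
  have hd' : (3 : ℝ) ≤ d := by exact_mod_cast hd
  have e : (2 * d : ℝ) - (d * (2 - 1 / (2 * (N + 1000)) + 3 / 8 / (N + 1000) ^ 2)
      + 3 / 2 / (N + 1000) ^ 2 * N) =
      (d * (4 * (N + 1000) - 3) - 12 * N) / (8 * (N + 1000) ^ 2) := by
    field_simp
    ring
  have : 0 ≤ (d * (4 * (N + 1000) - 3) - 12 * N) / (8 * (N + 1000) ^ 2) := by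
    apply div_nonneg _ (by positivity)
    -- The numerator is (4d - 12) N + 3997 d: this is where dimension at least three is used.
    nlinarith
  linarith

/-- The probability that the walk started at the origin ever visits `z`. -/
noncomputable def hitProb (d : ℕ) (z : Fin d → ℤ) : ℝ :=
  (walkLaw d).real {x | ∃ n, walk x n = z}

theorem measurableSet_hit {d : ℕ} (z : Fin d → ℤ) :
    MeasurableSet {x : ℕ → Fin d → ℤ | ∃ n, walk x n = z} :=
  measurableSet_exists_of_dependsOn fun n =>
    ⟨n, dependsOn_of_walk n (F := fun w => w n = z) fun w w' h => by rw [h n le_rfl]⟩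

theorem tendsto_measureReal_exists_le {α : Type*} [MeasurableSpace α] (μ : Measure α)
    [IsFiniteMeasure μ] (p : ℕ → α → Prop) :
    Tendsto (fun n => μ.real {x | ∃ j ≤ n, p j x}) atTop (nhds (μ.real {x | ∃ j, p j x})) := by
  have h : {x | ∃ j, p j x} = ⋃ n : ℕ, {x | ∃ j ≤ n, p j x} := by
    ext x
    simp only [Set.mem_iUnion]
    exact ⟨fun ⟨j, hj⟩ => ⟨j, j, le_rfl, hj⟩, fun ⟨_, j, _, hj⟩ => ⟨j, hj⟩⟩
  rw [h]
  refine (ENNReal.tendsto_toReal (measure_ne_top _ _)).comp (tendsto_measure_iUnion_atTop ?_)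
  rintro m n hmn x ⟨j, hj, hx⟩
  exact ⟨j, hj.trans hmn, hx⟩

/-- Optional stopping written as an induction: conditioning on the first step averages the bound
over the neighbours of z, and superharmonicity says that this average does not exceed the value at
z. -/
theorem hit_before_le {d : ℕ} (hd : 3 ≤ d) (n : ℕ) (z : Fin d → ℤ) :
    (walkLaw d).real {x | ∃ j ≤ n, walk x j = z} ≤ superharm z / superharm (0 : Fin d → ℤ) := by
  have : NeZero d := ⟨by omega⟩
  have hpos := superharm_pos (0 : Fin d → ℤ)
  induction n generalizing z with
  | zero =>
    by_cases hz : z = 0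
    · subst hz
      rw [div_self hpos.ne']
      exact measureReal_le_one
    · have : {x : ℕ → Fin d → ℤ | ∃ j ≤ 0, walk x j = z} = ∅ := by
        ext x; simp [Ne.symm hz]
      rw [this, measureReal_empty]
      exact (div_pos (superharm_pos z) hpos).le
  | succ n ih =>
    by_cases hz : z = 0
    · subst hz
      rw [div_self hpos.ne']
      exact measureReal_le_one
    have hset : {x : ℕ → Fin d → ℤ | ∃ j ≤ n + 1, walk x j = z} =
        {x | shift 1 x ∈ (fun e : Fin d → ℤ => {y : ℕ → Fin d → ℤ | ∃ j ≤ n, walk y j = z - e}) (x 0)} := by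
      ext x
      have hw : ∀ j, walk x (j + 1) = x 0 + walk (shift 1 x) j := by
        intro j; rw [add_comm j 1, walk_add, walk_succ]; simp
      constructor
      · rintro ⟨j, hj, h⟩
        rcases j with _ | j
        · exact absurd (by simpa using h.symm) hz
        · refine ⟨j, by omega, ?_⟩
          rw [← h, hw]; simp
      · rintro ⟨j, hj, h⟩
        refine ⟨j + 1, by omega, ?_⟩
        rw [hw, h]; abel
    rw [hset, walkLaw_first_step (Q := fun e : Fin d → ℤ => {y : ℕ → Fin d → ℤ | ∃ j ≤ n, walk y j = z - e})]
    · have hdpos : (0 : ℝ) < 2 * d := by positivity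
      rw [inv_mul_le_iff₀ hdpos]
      calc _ ≤ ∑ p : Fin d × ℤˣ, superharm (z + (Pi.single p.1 ((-p.2 : ℤˣ) : ℤ) : Fin d → ℤ)) / superharm (0 : Fin d → ℤ) := by
            refine Finset.sum_le_sum fun p _ => (ih _).trans (le_of_eq ?_)
            simp [sub_eq_add_neg, Pi.single_neg]
        _ = (∑ p : Fin d × ℤˣ, superharm (z + (Pi.single p.1 (p.2 : ℤ) : Fin d → ℤ))) /
            superharm (0 : Fin d → ℤ) := by
            rw [Finset.sum_div]
            exact Fintype.sum_equiv ((Equiv.refl _).prodCongr (Equiv.neg _)) _ _ (fun _ => rfl)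
        _ ≤ _ := by
            rw [← mul_div_assoc]
            exact div_le_div_of_nonneg_right (sum_superharm_le hd z) hpos.le
    · intro e
      exact measurableSet_walk n (F := fun w => ∃ j ≤ n, w j = z - e) fun w w' h =>
        propext ⟨fun ⟨j, hj, e⟩ => ⟨j, hj, h j hj ▸ e⟩, fun ⟨j, hj, e⟩ => ⟨j, hj, (h j hj).symm ▸ e⟩⟩

theorem hitProb_le_superharm {d : ℕ} (hd : 3 ≤ d) (z : Fin d → ℤ) :
    hitProb d z ≤ superharm z / superharm (0 : Fin d → ℤ) := by
  have : NeZero d := ⟨by omega⟩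
  exact le_of_tendsto' (tendsto_measureReal_exists_le (walkLaw d) fun n x => walk x n = z)
    fun n => hit_before_le hd n z

theorem superharm_zero {d : ℕ} : superharm (0 : Fin d → ℤ) = (1000 : ℝ) ^ (-(1 / 4) : ℝ) := by
  simp [superharm]

/-- A uniform bound for the probability to hit a site other than the origin. -/
noncomputable def hitBound : ℝ := (1001 : ℝ) ^ (-(1 / 4) : ℝ) / (1000 : ℝ) ^ (-(1 / 4) : ℝ)

theorem hitBound_lt_one : hitBound < 1 := by
  unfold hitBound
  rw [div_lt_one (by positivity)]
  exact Real.rpow_lt_rpow_of_neg (by norm_num) (by norm_num) (by norm_num)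

theorem hitProb_le_hitBound {d : ℕ} (hd : 3 ≤ d) {z : Fin d → ℤ} (hz : z ≠ 0) :
    hitProb d z ≤ hitBound := by
  refine (hitProb_le_superharm hd z).trans ?_
  rw [superharm_zero, hitBound]
  gcongr
  refine Real.rpow_le_rpow_of_nonpos (by norm_num) ?_ (by norm_num)
  obtain ⟨i, hi⟩ := Function.ne_iff.1 hz
  have h1 : (1 : ℝ) ≤ (z i : ℝ) ^ 2 := by
    have : (0 : ℤ) < z i ^ 2 := by have : z i ≠ 0 := hi; positivity
    exact_mod_cast this
  have := Finset.single_le_sum (f := fun j => (z j : ℝ) ^ 2) (fun j _ => sq_nonneg _)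
    (Finset.mem_univ i)
  linarith

/-- The probability to hit a site outside of a large box is small. -/
theorem hitProb_le_of_lt {d : ℕ} (hd : 3 ≤ d) {r : ℕ} (hr : r ≠ 0) {z : Fin d → ℤ} {i : Fin d}
    (hz : (r : ℤ) < |z i|) : hitProb d z ≤ 1000 * (r : ℝ) ^ (-(1 / 2) : ℝ) := by
  refine (hitProb_le_superharm hd z).trans ?_
  rw [superharm_zero, superharm]
  have hr0 : (0 : ℝ) < r := by positivity
  have h0 : (r : ℝ) ^ 2 ≤ (z i : ℝ) ^ 2 := by
    rw [← sq_abs (z i : ℝ)]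
    have : (r : ℝ) < |(z i : ℝ)| := by exact_mod_cast hz
    gcongr
  have h1 := Finset.single_le_sum (f := fun j => (z j : ℝ) ^ 2) (fun j _ => sq_nonneg _)
    (Finset.mem_univ i)
  have h2 : (∑ j, (z j : ℝ) ^ 2 + 1000) ^ (-(1 / 4) : ℝ) ≤ ((r : ℝ) ^ 2) ^ (-(1 / 4) : ℝ) :=
    Real.rpow_le_rpow_of_nonpos (by positivity) (by linarith) (by norm_num)
  have h3 : ((r : ℝ) ^ 2) ^ (-(1 / 4) : ℝ) = (r : ℝ) ^ (-(1 / 2) : ℝ) := by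
    rw [← Real.rpow_natCast, ← Real.rpow_mul hr0.le]; norm_num
  -- A crude bound for the value at the origin, the source of the factor 1000.
  have h4 : (1000 : ℝ)⁻¹ ≤ (1000 : ℝ) ^ (-(1 / 4) : ℝ) := by
    rw [← Real.rpow_neg_one]
    exact Real.rpow_le_rpow_of_exponent_le (by norm_num) (by norm_num)
  rw [div_le_iff₀ (by positivity)]
  calc _ ≤ (r : ℝ) ^ (-(1 / 2) : ℝ) := h2.trans h3.le
    _ = 1000 * (r : ℝ) ^ (-(1 / 2) : ℝ) * 1000⁻¹ := by ring
    _ ≤ _ := by gcongr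

/-! ### Returns to a site and to a pair of sites -/

/-- The probability that the walk returns to its starting point. -/
noncomputable def returnProb (d : ℕ) : ℝ := (walkLaw d).real {x | ∃ n, walk x (n + 1) = 0}

/-- The probability that the walk started at the origin returns to the pair `{0, z}`. -/
noncomputable def pairReturnProb (d : ℕ) (z : Fin d → ℤ) : ℝ :=
  (walkLaw d).real {x | ∃ n, walk x (n + 1) = 0 ∨ walk x (n + 1) = z}

theorem measurableSet_exists_walk {d : ℕ} (p : (Fin d → ℤ) → Prop) (k : ℕ) :
    MeasurableSet {x : ℕ → Fin d → ℤ | ∃ n, p (walk x (n + k))} :=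
  measurableSet_exists_of_dependsOn fun n =>
    ⟨n + k, dependsOn_of_walk (n + k) (F := fun w => p (w (n + k))) fun w w' h => by
      rw [h (n + k) le_rfl]⟩

theorem pairReturnProb_zero (d : ℕ) : pairReturnProb d 0 = returnProb d := by
  simp [pairReturnProb, returnProb]

theorem walkLaw_exists_walk_neg {d : ℕ} [NeZero d] (p : (Fin d → ℤ) → Prop) (k : ℕ) :
    (walkLaw d).real {x | ∃ n, p (- walk x (n + k))} =
      (walkLaw d).real {x | ∃ n, p (walk x (n + k))} := by
  conv_rhs => rw [← walkLaw_map_neg (NeZero.ne d)]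
  rw [map_measureReal_apply (by fun_prop) (measurableSet_exists_walk p k)]
  congr 1
  ext x
  change (∃ n, p (- walk x (n + k))) ↔ ∃ n, p (walk (fun i => - x i) (n + k))
  simp [walk_neg]

theorem hitProb_neg {d : ℕ} [NeZero d] (z : Fin d → ℤ) : hitProb d (-z) = hitProb d z := by
  have := walkLaw_exists_walk_neg (fun y => y = z) 0
  simp only [neg_eq_iff_eq_neg, add_zero] at this
  exact this

theorem pairReturnProb_neg {d : ℕ} [NeZero d] (z : Fin d → ℤ) :
    pairReturnProb d (-z) = pairReturnProb d z := by
  have := walkLaw_exists_walk_neg (fun y => y = 0 ∨ y = z) 1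
  simp only [neg_eq_iff_eq_neg, neg_zero] at this
  exact this

/-- After its first step e the walk must hit -e relative to its new position, and e is not zero. -/
theorem returnProb_le_hitBound {d : ℕ} (hd : 3 ≤ d) : returnProb d ≤ hitBound := by
  have : NeZero d := ⟨by omega⟩
  have hset : {x : ℕ → Fin d → ℤ | ∃ n, walk x (n + 1) = 0} =
      {x | shift 1 x ∈ (fun e : Fin d → ℤ => {y | ∃ n, walk y n = -e}) (x 0)} := by
    ext x
    change (∃ n, walk x (n + 1) = 0) ↔ ∃ n, walk (shift 1 x) n = - x 0
    refine exists_congr fun n => ?_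
    rw [add_comm n 1, walk_add, walk_succ]
    simp [add_eq_zero_iff_eq_neg']
  rw [returnProb, hset, walkLaw_first_step (Q := fun e : Fin d → ℤ => {y | ∃ n, walk y n = -e})
    (fun e => measurableSet_hit _)]
  have hdpos : (0 : ℝ) < 2 * d := by positivity
  rw [inv_mul_le_iff₀ hdpos]
  calc _ ≤ ∑ p : Fin d × ℤˣ, hitBound := by
        refine Finset.sum_le_sum fun p _ => hitProb_le_hitBound hd ?_
        simp
    _ = _ := by
        simp only [Finset.sum_const, Finset.card_univ, Fintype.card_prod, Fintype.card_fin,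
          Fintype.card_units_int, nsmul_eq_mul]
        push_cast
        ring

section Pair

variable {d : ℕ}

/-- The walk is at time `t ≥ 1` in the pair `{0, z}`. -/
def PairVisit (z : Fin d → ℤ) (t : ℕ) (x : ℕ → Fin d → ℤ) : Prop :=
  1 ≤ t ∧ (walk x t = 0 ∨ walk x t = z)

theorem dependsOn_pairVisit (z : Fin d → ℤ) (t : ℕ) :
    DependsOn (PairVisit z t) (Set.Iio t) := by
  refine dependsOn_of_walk t (F := fun w => 1 ≤ t ∧ (w t = 0 ∨ w t = z)) fun w w' h => ?_
  rw [h t le_rfl]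

/-- The first return to `{0, z}` takes place at `y`, at time `t`. -/
def PairReturnAt (z y : Fin d → ℤ) (t : ℕ) (x : ℕ → Fin d → ℤ) : Prop :=
  FirstAt (PairVisit z) t x ∧ walk x t = y

theorem dependsOn_pairReturnAt (z y : Fin d → ℤ) (t : ℕ) :
    DependsOn (PairReturnAt z y t) (Set.Iio t) := by
  intro x x' h
  unfold PairReturnAt
  rw [dependsOn_firstAt (dependsOn_pairVisit z) t h, walk_congr h le_rfl]

theorem le_pairReturnAt_hit [NeZero d] (z y v : Fin d → ℤ) :
    hitProb d v * (walkLaw d).real {x | ∃ t, PairReturnAt z y t x} ≤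
      (walkLaw d).real {x | ∃ t, PairReturnAt z y t x ∧ ∃ n, walk (shift t x) n = v} := by
  refine (le_walkLaw_stage (dependsOn_pairReturnAt z y)
    (Q := fun _ _ => {x | ∃ n, walk x n = v}) (fun _ _ _ _ => rfl)
    (fun _ _ => measurableSet_hit v) measureReal_nonneg (fun _ _ _ => le_rfl)).trans ?_
  refine measureReal_mono ?_
  rintro x ⟨t, ht, h⟩
  exact ⟨t, ht.1, h⟩

theorem measurableSet_pairReturnAt (z y : Fin d → ℤ) :
    MeasurableSet {x | ∃ t, PairReturnAt z y t x} :=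
  measurableSet_exists_of_dependsOn fun t => ⟨t, dependsOn_pairReturnAt z y t⟩

theorem pairReturnProb_eq [NeZero d] {z : Fin d → ℤ} (hz : z ≠ 0) :
    pairReturnProb d z = (walkLaw d).real {x | ∃ t, PairReturnAt z 0 t x} +
      (walkLaw d).real {x | ∃ t, PairReturnAt z z t x} := by
  rw [← measureReal_union _ (measurableSet_pairReturnAt z z)]
  · rw [pairReturnProb]
    congr 1
    ext x
    constructor
    · rintro ⟨n, hn⟩
      obtain ⟨t, ht⟩ := exists_firstAt (τ := PairVisit z) (x := x) ⟨n + 1, by omega, hn⟩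
      rcases ht.1.2 with h | h
      · exact Or.inl ⟨t, ht, h⟩
      · exact Or.inr ⟨t, ht, h⟩
    · rintro (⟨t, ht, h⟩ | ⟨t, ht, h⟩)
      · exact ⟨t - 1, by rw [Nat.sub_add_cancel ht.1.1]; exact Or.inl h⟩
      · exact ⟨t - 1, by rw [Nat.sub_add_cancel ht.1.1]; exact Or.inr h⟩
  · rw [Set.disjoint_left]
    rintro x ⟨t, ht, h⟩ ⟨s, hs, h'⟩
    rw [ht.unique hs, h'] at h
    exact hz h

/-- With a and b the probabilities that the first return to {0, z} is at 0 or at z: returning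
directly to 0, or returning first to z and then travelling by -z, are disjoint ways to return to 0.
-/
theorem le_returnProb [NeZero d] {z : Fin d → ℤ} (hz : z ≠ 0) :
    (walkLaw d).real {x | ∃ t, PairReturnAt z 0 t x} +
      hitProb d (-z) * (walkLaw d).real {x | ∃ t, PairReturnAt z z t x} ≤ returnProb d := by
  refine (add_le_add_right (le_pairReturnAt_hit z z (-z)) _).trans ?_
  rw [add_comm, ← measureReal_union _ (measurableSet_pairReturnAt z 0)]
  · refine measureReal_mono ?_
    rintro x (⟨t, ht, n, hn⟩ | ⟨t, ht, h⟩)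
    · refine ⟨t + n - 1, ?_⟩
      have := ht.1.1.1
      rw [Nat.sub_add_cancel (by omega), walk_add, hn, ht.2, add_neg_cancel]
    · exact ⟨t - 1, by rw [Nat.sub_add_cancel ht.1.1]; exact h⟩
  · rw [Set.disjoint_left]
    rintro x ⟨t, ⟨ht, h⟩, _⟩ ⟨s, hs, h'⟩
    rw [ht.unique hs, h'] at h
    exact hz h.symm

/-- The same decomposition for hitting z. It yields b / (1 - a) as a lower bound for the hitting
probability. -/
theorem le_hitProb [NeZero d] {z : Fin d → ℤ} (hz : z ≠ 0) :
    (walkLaw d).real {x | ∃ t, PairReturnAt z z t x} +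
      hitProb d z * (walkLaw d).real {x | ∃ t, PairReturnAt z 0 t x} ≤ hitProb d z := by
  refine (add_le_add_right (le_pairReturnAt_hit z 0 z) _).trans ?_
  rw [add_comm, ← measureReal_union _ (measurableSet_pairReturnAt z z)]
  · refine measureReal_mono ?_
    rintro x (⟨t, ht, n, hn⟩ | ⟨t, ht, h⟩)
    · exact ⟨t + n, by rw [walk_add, hn, ht.2, zero_add]⟩
    · exact ⟨t, h⟩
  · rw [Set.disjoint_left]
    rintro x ⟨t, ⟨ht, h⟩, _⟩ ⟨s, hs, h'⟩
    rw [ht.unique hs, h'] at h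
    exact hz h

/-- One step out and back along a unit vector other than z; of the two signs on an axis at least one
is allowed. -/
theorem le_pairReturnAt_zero [NeZero d] (z : Fin d → ℤ) :
    ((2 * (d : ℝ))⁻¹) ^ 2 ≤ (walkLaw d).real {x | ∃ t, PairReturnAt z 0 t x} := by
  let i : Fin d := ⟨0, Nat.pos_of_ne_zero (NeZero.ne d)⟩
  obtain ⟨s, hs⟩ : ∃ s : ℤˣ, (Pi.single i (s : ℤ) : Fin d → ℤ) ≠ z := by
    by_contra! h
    have := injective_unitVector (a₁ := (i, (1 : ℤˣ))) (a₂ := (i, -1)) ((h 1).trans (h (-1)).symm)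
    simp at this
  set e : Fin d → ℤ := Pi.single i (s : ℤ) with he
  have he0 : e ≠ 0 := by simp [he]
  have h1 : (walkLaw d) {x | x 0 = e ∧ x 1 = -e} = ((2 * (d : ENNReal))⁻¹) ^ 2 := by
    have h : {x : ℕ → Fin d → ℤ | x 0 = e ∧ x 1 = -e} =
        Set.pi ((({0, 1} : Finset ℕ)) : Set ℕ) (fun k => {if k = 0 then e else -e}) := by
      ext x; simp
    rw [h, walkLaw, Measure.infinitePi_pi _ (fun _ _ => MeasurableSet.singleton _),
      Finset.prod_pair (by norm_num)]
    have hone : ∀ s : ℤˣ, stepLaw d {(Pi.single i (s : ℤ) : Fin d → ℤ)} = (2 * (d : ENNReal))⁻¹ := by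
      intro s
      rw [stepLaw_apply, Finset.sum_eq_single (i, s)]
      · simp
      · rintro p _ hne
        rw [Set.indicator_of_notMem, mul_zero]
        exact fun hmem => hne (injective_unitVector hmem)
      · simp
    have hm : -e = Pi.single i ((-s : ℤˣ) : ℤ) := by simp [he, Pi.single_neg]
    rw [if_pos rfl, if_neg one_ne_zero, hm, he, hone, hone, sq]
  have h2 : (walkLaw d).real {x | x 0 = e ∧ x 1 = -e} = ((2 * (d : ℝ))⁻¹) ^ 2 := by
    simp [Measure.real, h1, ENNReal.toReal_mul]
  rw [← h2]
  refine measureReal_mono ?_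
  rintro x ⟨hx0, hx1⟩
  have w1 : walk x 1 = e := by simp [walk, hx0]
  have w2 : walk x 2 = 0 := by simp [walk, Finset.sum_range_succ, hx0, hx1]
  refine ⟨2, ⟨⟨by norm_num, Or.inl w2⟩, ?_⟩, w2⟩
  rintro r hr ⟨hr1, h⟩
  obtain rfl : r = 1 := by omega
  rw [w1] at h
  exact h.elim he0 hs

theorem returnProb_pos [NeZero d] : 0 < returnProb d := by
  have h1 := le_pairReturnAt_zero (0 : Fin d → ℤ)
  have h2 : (0 : ℝ) < ((2 * (d : ℝ))⁻¹) ^ 2 := by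
    have : (0 : ℝ) < d := by exact_mod_cast Nat.pos_of_ne_zero (NeZero.ne d)
    positivity
  refine lt_of_lt_of_le h2 (h1.trans (measureReal_mono ?_))
  rintro x ⟨t, ht, h⟩
  exact ⟨t - 1, by rw [Nat.sub_add_cancel ht.1.1]; exact h⟩

/-- Two distinct sites: the probability to return to the pair is, uniformly in the pair, less than
the square root of the probability to return to a single site. -/
theorem exists_pairReturnProb_sq_le (hd : 3 ≤ d) :
    ∃ η > 0, ∀ z : Fin d → ℤ, z ≠ 0 → pairReturnProb d z ^ 2 ≤ returnProb d - η := by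
  have : NeZero d := ⟨by omega⟩
  have hdpos : (0 : ℝ) < d := by exact_mod_cast (by omega : 0 < d)
  have hb := hitBound_lt_one
  -- The gap in the identity for (a + b)² below is a / (1 - a) · (1 - a - b)². The first factor
  -- comes from a ≥ (2d)⁻², the second from 1 - a - b ≥ (1 - a)(1 - h) with both factors at least 1
  -- - `hitBound`.
  refine ⟨((2 * (d : ℝ))⁻¹) ^ 2 * ((1 - hitBound) * (1 - hitBound)) ^ 2, ?_, fun z hz => ?_⟩
  · have : 0 < 1 - hitBound := by linarith
    positivity
  rw [pairReturnProb_eq hz]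
  have h1 := le_returnProb hz
  have h2 := le_hitProb hz
  have h3 := le_pairReturnAt_zero z
  have h4 := hitProb_le_hitBound hd hz
  have h5 := returnProb_le_hitBound hd
  rw [hitProb_neg] at h1
  set a := (walkLaw d).real {x | ∃ t, PairReturnAt z 0 t x}
  set b := (walkLaw d).real {x | ∃ t, PairReturnAt z z t x}
  set h := hitProb d z
  set q := returnProb d
  have ha : 0 ≤ a := measureReal_nonneg
  have hb0 : 0 ≤ b := measureReal_nonneg
  have hh : 0 ≤ h := measureReal_nonneg
  set c := ((2 * (d : ℝ))⁻¹) ^ 2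
  set g := 1 - hitBound
  have hg : 0 < g := by linarith
  have hc : 0 ≤ c := by positivity
  have haq : a ≤ q := by nlinarith [mul_nonneg hh hb0]
  have ha1 : g ≤ 1 - a := by linarith
  have hab : g * g ≤ 1 - a - b := by nlinarith
  have hsq : (g * g) ^ 2 ≤ (1 - a - b) ^ 2 := by
    have : 0 ≤ g * g := by positivity
    gcongr
  have hh' : b / (1 - a) ≤ h := by
    rw [div_le_iff₀ (by linarith)]; linarith
  -- Insert the lower bound for h into the inequality a + h b ≤ q.
  have hq : a + b * (b / (1 - a)) ≤ q := by nlinarith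
  have hpos : 0 < 1 - a := by linarith
  have e : (a + b) ^ 2 = a + b * (b / (1 - a)) - a / (1 - a) * (1 - a - b) ^ 2 := by
    field_simp
    ring
  have h6 : c * (g * g) ^ 2 ≤ a / (1 - a) * (1 - a - b) ^ 2 := by
    apply mul_le_mul _ hsq (by positivity) (by positivity)
    rw [le_div_iff₀ hpos]
    nlinarith
  linarith

end Pair

section Visits

variable {d : ℕ}

/-- The number of visits of `w` to the pair `{0, z}` at times `1, …, n`. -/
def pairVisits (z : Fin d → ℤ) (w : ℕ → Fin d → ℤ) (n : ℕ) : ℕ :=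
  ((Finset.range n).filter (fun j => w (j + 1) = 0 ∨ w (j + 1) = z)).card

theorem pairVisits_succ (z : Fin d → ℤ) (w : ℕ → Fin d → ℤ) (n : ℕ) :
    pairVisits z w (n + 1) =
      pairVisits z w n + if w (n + 1) = 0 ∨ w (n + 1) = z then 1 else 0 := by
  unfold pairVisits
  rw [Finset.range_add_one, Finset.filter_insert]
  split_ifs
  · rw [Finset.card_insert_of_notMem (by simp)]
  · simp

theorem pairVisits_congr (z : Fin d → ℤ) {n : ℕ} {w w' : ℕ → Fin d → ℤ}
    (h : ∀ m ≤ n, w m = w' m) : pairVisits z w n = pairVisits z w' n := by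
  unfold pairVisits
  congr 1
  refine Finset.filter_congr fun j hj => ?_
  rw [h (j + 1) (by have := Finset.mem_range.1 hj; omega)]

theorem pairVisits_add_eq (z : Fin d → ℤ) (w : ℕ → Fin d → ℤ) (t n : ℕ)
    (h : ∀ j, j < n → ¬ (w (t + j + 1) = 0 ∨ w (t + j + 1) = z)) :
    pairVisits z w (t + n) = pairVisits z w t := by
  induction n with
  | zero => rfl
  | succ n ih =>
    rw [← add_assoc, pairVisits_succ, if_neg (h n (by omega)), add_zero,
      ih fun j hj => h j (by omega)]

/-- At the time of the m-th visit the walk is at 0 or z (at 0 if m = 0), and by reflection the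
chance of coming back to the pair is the same from both. -/
theorem walkLaw_pairVisits_le [NeZero d] (z : Fin d → ℤ) (m : ℕ) :
    (walkLaw d).real {x | ∃ n, m ≤ pairVisits z (walk x) n} ≤ pairReturnProb d z ^ m := by
  induction m with
  | zero => simp
  | succ m ih =>
    have hτ : ∀ t, DependsOn (fun x : ℕ → Fin d → ℤ => m ≤ pairVisits z (walk x) t) (Set.Iio t) :=
      fun t => dependsOn_of_walk t (F := fun w => m ≤ pairVisits z w t) fun w w' h => by
        rw [pairVisits_congr z h]
    have key := walkLaw_stage_le hτ
      (Q := fun t x => {y | ∃ n, (fun v => v = - walk x t ∨ v = z - walk x t) (walk y (n + 1))})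
      (p := pairReturnProb d z)
      (fun t x y h => by
        change {y | _} = {y | _}
        simp only [walk_congr h le_rfl])
      (fun t x => measurableSet_exists_walk (fun v => v = - walk x t ∨ v = z - walk x t) 1) measureReal_nonneg ?_
    · calc _ ≤ _ := measureReal_mono ?_
        _ ≤ _ := key
        _ ≤ _ := by rw [pow_succ']; exact mul_le_mul_of_nonneg_left ih measureReal_nonneg
      rintro x ⟨n, hn⟩
      obtain ⟨t, ht⟩ := exists_firstAt (τ := fun t x => m ≤ pairVisits z (walk x) t) (x := x)
        ⟨n, by omega⟩
      refine ⟨t, ht, ?_⟩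
      by_contra hcon
      have hno : ∀ j, ¬ (walk x (t + j + 1) = 0 ∨ walk x (t + j + 1) = z) := by
        intro j hj
        apply hcon
        refine ⟨j, ?_⟩
        rw [add_assoc, walk_add] at hj
        refine hj.imp (fun h => ?_) (fun h => ?_)
        · rw [← sub_eq_zero, ← h]; abel
        · rw [← h]; abel
      have hcard : pairVisits z (walk x) t ≤ m := by
        rcases t with _ | t
        · simp [pairVisits]
        · have := ht.2 t (by omega)
          rw [pairVisits_succ]
          split_ifs <;> omega
      rcases le_total n t with hnt | hnt
      · have : pairVisits z (walk x) n ≤ pairVisits z (walk x) t :=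
          Finset.card_le_card (Finset.filter_subset_filter _ (Finset.range_mono hnt))
        omega
      · obtain ⟨k, rfl⟩ := Nat.exists_eq_add_of_le hnt
        rw [pairVisits_add_eq z _ t k fun j _ => hno j] at hn
        omega
    · intro t x ht
      have hmem : walk x t = 0 ∨ walk x t = z := by
        rcases t with _ | t
        · simp
        · have h1 := ht.2 t (by omega)
          have h2 := ht.1
          simp only [pairVisits_succ] at h2
          split_ifs at h2 with h
          · exact h
          · simp only [add_zero] at h2; exact absurd h2 h1
      rcases hmem with h | h
      · simp only [h, neg_zero, sub_zero]
        exact le_rfl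
      -- Seen from z the pair is {0, -z}.
      · rw [← pairReturnProb_neg]
        simp only [h, sub_self]
        refine measureReal_mono ?_
        rintro y ⟨n, hn⟩
        exact ⟨n, hn.symm⟩

end Visits

/-! ### Deterministic evolution of the favorite sites -/

section Favorites

variable {d : ℕ} {w : ℕ → Fin d → ℤ}

theorem localTime_succ (w : ℕ → Fin d → ℤ) (x : Fin d → ℤ) (n : ℕ) :
    localTime w x (n + 1) = localTime w x n + if w (n + 1) = x then 1 else 0 := by
  unfold localTime
  rw [Finset.range_add_one (n := n + 1), Finset.filter_insert]
  split_ifs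
  · rw [Finset.card_insert_of_notMem (by simp)]
  · simp

theorem localTime_zero (w : ℕ → Fin d → ℤ) (x : Fin d → ℤ) :
    localTime w x 0 = if w 0 = x then 1 else 0 := by
  unfold localTime
  rw [zero_add, Finset.range_one, Finset.filter_singleton]
  split_ifs <;> rfl

theorem localTime_mono (w : ℕ → Fin d → ℤ) (x : Fin d → ℤ) : Monotone (localTime w x) :=
  monotone_nat_of_le_succ fun n => by rw [localTime_succ]; omega

theorem localTime_congr {w w' : ℕ → Fin d → ℤ} {n : ℕ} (h : ∀ m ≤ n, w m = w' m)
    (x : Fin d → ℤ) : localTime w x n = localTime w' x n := by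
  unfold localTime
  congr 1
  refine Finset.filter_congr fun j hj => ?_
  rw [h j (by have := Finset.mem_range.1 hj; omega)]

theorem maxLocalTime_congr {w w' : ℕ → Fin d → ℤ} {n : ℕ} (h : ∀ m ≤ n, w m = w' m) :
    maxLocalTime w n = maxLocalTime w' n := by
  unfold maxLocalTime
  simp only [localTime_congr h]

theorem favoriteSites_congr {w w' : ℕ → Fin d → ℤ} {n : ℕ} (h : ∀ m ≤ n, w m = w' m) :
    favoriteSites w n = favoriteSites w' n := by
  unfold favoriteSites
  simp only [localTime_congr h, maxLocalTime_congr h]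

theorem localTime_le_maxLocalTime (w : ℕ → Fin d → ℤ) (x : Fin d → ℤ) (n : ℕ) :
    localTime w x n ≤ maxLocalTime w n := le_ciSup (bddAbove_localTime w n) x

theorem exists_mem_favoriteSites (w : ℕ → Fin d → ℤ) (n : ℕ) : ∃ x, x ∈ favoriteSites w n :=
  Nat.sSup_mem (Set.range_nonempty _) (bddAbove_localTime w n)

theorem maxLocalTime_mono (w : ℕ → Fin d → ℤ) : Monotone (maxLocalTime w) := by
  intro m n hmn
  obtain ⟨x, hx⟩ := exists_mem_favoriteSites w m
  rw [← show localTime w x m = _ from hx]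
  exact (localTime_mono w x hmn).trans (localTime_le_maxLocalTime w x n)

theorem maxLocalTime_pos (w : ℕ → Fin d → ℤ) (n : ℕ) : 1 ≤ maxLocalTime w n := by
  refine le_trans ?_ ((localTime_mono w (w 0) (Nat.zero_le n)).trans
    (localTime_le_maxLocalTime w (w 0) n))
  simp [localTime_zero]

theorem maxLocalTime_succ_le (w : ℕ → Fin d → ℤ) (n : ℕ) :
    maxLocalTime w (n + 1) ≤ maxLocalTime w n + 1 := by
  obtain ⟨x, hx⟩ := exists_mem_favoriteSites w (n + 1)
  rw [← show localTime w x (n + 1) = _ from hx, localTime_succ]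
  have := localTime_le_maxLocalTime w x n
  split_ifs <;> omega

theorem maxLocalTime_zero (w : ℕ → Fin d → ℤ) : maxLocalTime w 0 = 1 := by
  obtain ⟨x, hx⟩ := exists_mem_favoriteSites w 0
  have h1 := maxLocalTime_pos w 0
  rw [← show localTime w x 0 = _ from hx, localTime_zero] at h1 ⊢
  split_ifs at h1 ⊢ <;> omega

theorem maxLocalTime_le (w : ℕ → Fin d → ℤ) (n : ℕ) : maxLocalTime w n ≤ n + 1 := by
  induction n with
  | zero => rw [maxLocalTime_zero]
  | succ n ih => exact (maxLocalTime_succ_le w n).trans (by omega)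

theorem favoriteSites_zero (w : ℕ → Fin d → ℤ) : favoriteSites w 0 = {w 0} := by
  ext x
  simp only [favoriteSites, maxLocalTime_zero, localTime_zero, Set.mem_ofPred_eq,
    Set.mem_singleton_iff]
  by_cases h : w 0 = x
  · simp [h]
  · simp [h, Ne.symm h]

theorem favoriteSites_subset {m n : ℕ} (hmn : m ≤ n) (h : maxLocalTime w m = maxLocalTime w n) :
    favoriteSites w m ⊆ favoriteSites w n := by
  intro x (hx : localTime w x m = _)
  refine le_antisymm (localTime_le_maxLocalTime w x n) ?_
  rw [← h, ← hx]
  exact localTime_mono w x hmn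

/-- Visiting a current favorite raises the level, so none is visited while the level stays the same.
-/
theorem notMem_favoriteSites_of_lt {m j n : ℕ} (hmj : m < j) (hjn : j ≤ n)
    (h : maxLocalTime w m = maxLocalTime w n) : w j ∉ favoriteSites w m := by
  intro (hx : localTime w (w j) m = _)
  obtain ⟨i, rfl⟩ : ∃ i, j = i + 1 := ⟨j - 1, by omega⟩
  have h1 := localTime_succ w (w (i + 1)) i
  rw [if_pos rfl] at h1
  have h2 := localTime_mono w (w (i + 1)) (show m ≤ i by omega)
  have h3 := localTime_mono w (w (i + 1)) hjn
  have h4 := localTime_le_maxLocalTime w (w (i + 1)) n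
  omega

theorem maxLocalTime_succ_of_mem {n : ℕ} (h : w (n + 1) ∈ favoriteSites w n) :
    maxLocalTime w (n + 1) = maxLocalTime w n + 1 := by
  refine le_antisymm (maxLocalTime_succ_le w n) ?_
  have h1 := localTime_succ w (w (n + 1)) n
  rw [if_pos rfl, show localTime w (w (n + 1)) n = _ from h] at h1
  rw [← h1]
  exact localTime_le_maxLocalTime _ _ _

theorem maxLocalTime_succ_of_notMem {n : ℕ} (h : w (n + 1) ∉ favoriteSites w n) :
    maxLocalTime w (n + 1) = maxLocalTime w n := by
  refine le_antisymm ?_ (maxLocalTime_mono w (Nat.le_succ n))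
  obtain ⟨x, hx⟩ := exists_mem_favoriteSites w (n + 1)
  rw [← show localTime w x (n + 1) = _ from hx, localTime_succ]
  have h1 := localTime_le_maxLocalTime w x n
  split_ifs with hwx
  · subst hwx
    have : localTime w (w (n + 1)) n ≠ maxLocalTime w n := h
    omega
  · omega

theorem favoriteSites_succ_of_mem {n : ℕ} (h : w (n + 1) ∈ favoriteSites w n) :
    favoriteSites w (n + 1) = {w (n + 1)} := by
  have h0 := maxLocalTime_succ_of_mem h
  ext x
  simp only [favoriteSites, Set.mem_ofPred_eq, Set.mem_singleton_iff, h0, localTime_succ]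
  have h1 := localTime_le_maxLocalTime w x n
  have h2 : localTime w (w (n + 1)) n = maxLocalTime w n := h
  constructor
  · intro hx
    by_contra hne
    rw [if_neg (Ne.symm hne)] at hx
    omega
  · rintro rfl
    rw [if_pos rfl, h2]

theorem favoriteSites_succ_of_notMem {n : ℕ} (h : w (n + 1) ∉ favoriteSites w n)
    (h' : w (n + 1) ∉ favoriteSites w (n + 1)) : favoriteSites w (n + 1) = favoriteSites w n := by
  have h0 := maxLocalTime_succ_of_notMem h
  ext x
  by_cases hx : w (n + 1) = x
  · subst hx; exact iff_of_false h' h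
  · simp only [favoriteSites, Set.mem_ofPred_eq, h0, localTime_succ, if_neg hx, add_zero]

theorem favoriteSites_succ_of_mem_succ {n : ℕ} (h : w (n + 1) ∉ favoriteSites w n)
    (h' : w (n + 1) ∈ favoriteSites w (n + 1)) :
    favoriteSites w (n + 1) = insert (w (n + 1)) (favoriteSites w n) := by
  have h0 := maxLocalTime_succ_of_notMem h
  ext x
  rw [Set.mem_insert_iff]
  by_cases hx : w (n + 1) = x
  · subst hx; exact iff_of_true h' (Or.inl rfl)
  · simp only [favoriteSites, Set.mem_ofPred_eq, h0, localTime_succ, if_neg hx, add_zero,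
      Ne.symm hx, false_or]

/-- At time `n` the maximal local time is `k` and there are `i` favorite sites. -/
def FavoriteState (w : ℕ → Fin d → ℤ) (k i n : ℕ) : Prop :=
  maxLocalTime w n = k ∧ (favoriteSites w n).ncard = i

theorem favoriteState_congr {w w' : ℕ → Fin d → ℤ} {n : ℕ} (h : ∀ m ≤ n, w m = w' m) (k i : ℕ) :
    FavoriteState w k i n ↔ FavoriteState w' k i n := by
  unfold FavoriteState
  rw [maxLocalTime_congr h, favoriteSites_congr h]

/-- Within a level favorites are only added, so equal cardinality forces equal sets. -/
theorem FavoriteState.favoriteSites_eq {k i m n : ℕ} (hm : FavoriteState w k i m)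
    (hn : FavoriteState w k i n) : favoriteSites w m = favoriteSites w n := by
  rcases le_total m n with h | h
  · exact Set.eq_of_subset_of_ncard_le (favoriteSites_subset h (hm.1.trans hn.1.symm))
      (hn.2.trans hm.2.symm).le (finite_favoriteSites w n)
  · exact (Set.eq_of_subset_of_ncard_le (favoriteSites_subset h (hn.1.trans hm.1.symm))
      (hm.2.trans hn.2.symm).le (finite_favoriteSites w m)).symm

/-- When a state is first entered, the current position is a favorite site. -/
theorem mem_favoriteSites_of_first {k i t : ℕ} (ht : FavoriteState w k i t)
    (hfirst : ∀ s < t, ¬ FavoriteState w k i s) : w t ∈ favoriteSites w t := by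
  rcases t with _ | s
  · simp [favoriteSites_zero]
  · by_contra hcon
    have h1 : w (s + 1) ∉ favoriteSites w s := by
      intro h
      rw [favoriteSites_succ_of_mem h] at hcon
      exact hcon rfl
    refine hfirst s (Nat.lt_succ_self s) ⟨?_, ?_⟩
    · rw [← ht.1, maxLocalTime_succ_of_notMem h1]
    · rw [← ht.2, favoriteSites_succ_of_notMem h1 hcon]

/-- Within a level the count starts at one and grows by single sites, so no value is skipped. -/
theorem exists_favoriteState_pred {k i n : ℕ} (hi : 1 ≤ i) (hn : FavoriteState w k (i + 1) n) :
    ∃ t < n, FavoriteState w k i t := by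
  classical
  have hex : ∃ n, FavoriteState w k (i + 1) n := ⟨n, hn⟩
  have hspec := Nat.find_spec hex
  have hmin := fun s => Nat.find_min hex (m := s)
  have hle : Nat.find hex ≤ n := Nat.find_min' hex hn
  set t := Nat.find hex
  have hmem := mem_favoriteSites_of_first hspec fun s hs => hmin s hs
  rcases t with _ | s
  · have := hspec.2
    rw [favoriteSites_zero, Set.ncard_singleton] at this
    omega
  · by_cases h : w (s + 1) ∈ favoriteSites w s
    · have := hspec.2
      rw [favoriteSites_succ_of_mem h, Set.ncard_singleton] at this
      omega
    · refine ⟨s, by omega, ?_, ?_⟩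
      · rw [← hspec.1, maxLocalTime_succ_of_notMem h]
      · have := hspec.2
        rw [favoriteSites_succ_of_mem_succ h hmem,
          Set.ncard_insert_of_notMem h (finite_favoriteSites w s)] at this
        omega

/-- If the favorite sites are never visited again while the maximal local time grows, then
another favorite site appears at the same level. -/
theorem exists_favoriteState_succ {k i t : ℕ} (ht : FavoriteState w k i t)
    (hno : ∀ s, t < s → w s ∉ favoriteSites w t) (htop : ∃ n, k < maxLocalTime w n) :
    ∃ s, t < s ∧ FavoriteState w k (i + 1) s := by
  classical
  have hex : ∃ m, ¬ FavoriteState w k i (t + m) := by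
    obtain ⟨n, hn⟩ := htop
    refine ⟨n, fun h => ?_⟩
    have := maxLocalTime_mono w (show n ≤ t + n by omega)
    rw [h.1] at this
    omega
  have hspec := Nat.find_spec hex
  have hmin := fun s => Nat.find_min hex (m := s)
  set m := Nat.find hex
  rcases m with _ | m
  · exact absurd ht hspec
  · have hm : FavoriteState w k i (t + m) := not_not.1 (hmin m (Nat.lt_succ_self m))
    have hK := ht.favoriteSites_eq hm
    have h1 : w (t + m + 1) ∉ favoriteSites w (t + m) := hK ▸ hno _ (by omega)
    refine ⟨t + m + 1, by omega, ?_, ?_⟩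
    · rw [maxLocalTime_succ_of_notMem h1, hm.1]
    · by_cases h2 : w (t + m + 1) ∈ favoriteSites w (t + m + 1)
      · rw [favoriteSites_succ_of_mem_succ h1 h2,
          Set.ncard_insert_of_notMem h1 (finite_favoriteSites w _), hm.2]
      · refine absurd ⟨?_, ?_⟩ hspec
        · rw [← add_assoc, maxLocalTime_succ_of_notMem h1, hm.1]
        · rw [← add_assoc, favoriteSites_succ_of_notMem h1 h2, hm.2]

/-- At the moment a level is reached, the site just visited is its only favorite. -/
theorem exists_favoriteState_one {k : ℕ} (hk : 1 ≤ k) (htop : ∃ n, k ≤ maxLocalTime w n) :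
    ∃ n, FavoriteState w k 1 n := by
  classical
  have hspec := Nat.find_spec htop
  have hmin := fun s => Nat.find_min htop (m := s)
  set n := Nat.find htop
  rcases n with _ | n
  · refine ⟨0, ?_, ?_⟩
    · rw [maxLocalTime_zero] at hspec ⊢; omega
    · rw [favoriteSites_zero, Set.ncard_singleton]
  · have h1 := hmin n (Nat.lt_succ_self n)
    have h2 := maxLocalTime_succ_le w n
    have h3 : w (n + 1) ∈ favoriteSites w n := by
      by_contra h
      rw [maxLocalTime_succ_of_notMem h] at hspec
      exact h1 hspec
    refine ⟨n + 1, by omega, ?_⟩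
    rw [favoriteSites_succ_of_mem h3, Set.ncard_singleton]

/-- Distinct points of `K` differ by more than `r` in some coordinate. -/
def Separated (r : ℕ) (K : Set (Fin d → ℤ)) : Prop :=
  ∀ x ∈ K, ∀ y ∈ K, x ≠ y → ∃ i, (r : ℤ) < |x i - y i|

theorem Separated.subset {r : ℕ} {K L : Set (Fin d → ℤ)} (hL : Separated r L) (h : K ⊆ L) :
    Separated r K := fun x hx y hy hne => hL x (h hx) y (h hy) hne

theorem Separated.mono {r s : ℕ} {K : Set (Fin d → ℤ)} (hK : Separated s K) (h : r ≤ s) :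
    Separated r K := fun x hx y hy hne => by
  obtain ⟨i, hi⟩ := hK x hx y hy hne
  exact ⟨i, by omega⟩

theorem localTime_translate (w : ℕ → Fin d → ℤ) (a x : Fin d → ℤ) (n : ℕ) :
    localTime (fun j => a + w j) x n = localTime w (x - a) n := by
  unfold localTime
  congr 1
  refine Finset.filter_congr fun j _ => ?_
  rw [eq_sub_iff_add_eq, add_comm]

theorem maxLocalTime_translate (w : ℕ → Fin d → ℤ) (a : Fin d → ℤ) (n : ℕ) :
    maxLocalTime (fun j => a + w j) n = maxLocalTime w n := by
  unfold maxLocalTime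
  simp only [localTime_translate]
  exact (Equiv.subRight a).surjective.iSup_comp (fun y => localTime w y n)

theorem ncard_favoriteSites_translate (w : ℕ → Fin d → ℤ) (a : Fin d → ℤ) (n : ℕ) :
    (favoriteSites (fun j => a + w j) n).ncard = (favoriteSites w n).ncard := by
  have : favoriteSites (fun j => a + w j) n = (fun x => x + a) '' favoriteSites w n := by
    ext x
    simp only [favoriteSites, localTime_translate, maxLocalTime_translate, Set.mem_ofPred_eq,
      Set.mem_image]
    exact ⟨fun h => ⟨x - a, h, sub_add_cancel x a⟩, fun ⟨y, hy, e⟩ => by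
      rw [← e, add_sub_cancel_right]; exact hy⟩
  rw [this, Set.ncard_image_of_injective _ (add_left_injective a)]

/-- After its first visit to `{y, z}`, the walk makes all but one of its visits to the pair. -/
theorem exists_first_visit_pair {y z : Fin d → ℤ} {N : ℕ} (hy : 1 ≤ localTime w y N) :
    ∃ t ≤ N, (w t = y ∨ w t = z) ∧
      ((Finset.range (N + 1)).filter (fun j => w j = y ∨ w j = z)).card =
      1 + ((Finset.range (N - t)).filter
        (fun j => w (t + (j + 1)) = y ∨ w (t + (j + 1)) = z)).card := by
  classical
  have hex : ∃ t, w t = y ∨ w t = z := by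
    obtain ⟨j, hj⟩ := Finset.card_pos.1 (show 0 < localTime w y N by omega)
    exact ⟨j, Or.inl (Finset.mem_filter.1 hj).2⟩
  have hspec := Nat.find_spec hex
  have hmin := fun s => Nat.find_min hex (m := s)
  have hle : Nat.find hex ≤ N := by
    obtain ⟨j, hj⟩ := Finset.card_pos.1 (show 0 < localTime w y N by omega)
    rw [Finset.mem_filter, Finset.mem_range] at hj
    exact (Nat.find_min' hex (Or.inl hj.2)).trans (by omega)
  set t := Nat.find hex
  refine ⟨t, hle, hspec, ?_⟩
  have hset : (Finset.range (N + 1)).filter (fun j => w j = y ∨ w j = z) =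
      insert t (((Finset.range (N - t)).filter
        (fun j => w (t + (j + 1)) = y ∨ w (t + (j + 1)) = z)).image (fun j => t + (j + 1))) := by
    ext j
    simp only [Finset.mem_filter, Finset.mem_range, Finset.mem_insert, Finset.mem_image]
    constructor
    · rintro ⟨h1, h2⟩
      rcases lt_trichotomy j t with h | h | h
      · exact absurd h2 (hmin j h)
      · exact Or.inl h
      · refine Or.inr ⟨j - t - 1, ⟨by omega, ?_⟩, by omega⟩
        rwa [show t + (j - t - 1 + 1) = j by omega]
    · rintro (rfl | ⟨i, ⟨h1, h2⟩, rfl⟩)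
      · exact ⟨by omega, hspec⟩
      · exact ⟨by omega, h2⟩
  rw [hset, Finset.card_insert_of_notMem, Finset.card_image_of_injective, add_comm]
  · intro a b h; simp only at h; omega
  · simp

end Favorites

/-! ### From local times to returns after a first visit -/

section FirstVisit

variable {d : ℕ}

theorem exists_pairVisits_of_localTime {x : ℕ → Fin d → ℤ} {y : Fin d → ℤ} {k N : ℕ} (hk : 1 ≤ k)
    (h : k ≤ localTime (walk x) y N) :
    ∃ t ≤ N, ∃ n, k - 1 ≤ pairVisits 0 (walk (shift t x)) n := by
  obtain ⟨t, ht, hw, hc⟩ := exists_first_visit_pair (z := y) (hk.trans h)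
  simp only [or_self] at hw hc
  refine ⟨t, ht, N - t, ?_⟩
  change localTime (walk x) y N = _ at hc
  have : pairVisits 0 (walk (shift t x)) (N - t) =
      ((Finset.range (N - t)).filter (fun j => walk x (t + (j + 1)) = y)).card := by
    unfold pairVisits
    congr 1
    refine Finset.filter_congr fun j _ => ?_
    rw [walk_add x t, hw]
    simp
  omega

/-- The two local times add up to 2k visits to the pair; one of them is the first visit, from which
the remaining ones are counted. The sign of v records which site is visited first. -/
theorem exists_pairVisits_of_localTime_pair {x : ℕ → Fin d → ℤ} {y z : Fin d → ℤ} {k N : ℕ}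
    (hk : 1 ≤ k) (hyz : y ≠ z) (hy : k ≤ localTime (walk x) y N)
    (hz : k ≤ localTime (walk x) z N) :
    ∃ t ≤ N, ∃ v, (v = z - y ∨ v = y - z) ∧
      ∃ n, 2 * k - 1 ≤ pairVisits v (walk (shift t x)) n := by
  obtain ⟨t, ht, hw, hc⟩ := exists_first_visit_pair (z := z) (hk.trans hy)
  have hsum : ((Finset.range (N + 1)).filter (fun j => walk x j = y ∨ walk x j = z)).card =
      localTime (walk x) y N + localTime (walk x) z N := by
    classical
    rw [Finset.filter_or, Finset.card_union_of_disjoint]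
    · rfl
    · rw [Finset.disjoint_filter]
      intro j _ h1 h2
      exact hyz (h1.symm.trans h2)
  refine ⟨t, ht, ?_⟩
  have hvis : ∀ v, (∀ u : Fin d → ℤ, (u = 0 ∨ u = v) ↔ (walk x t + u = y ∨ walk x t + u = z)) →
      pairVisits v (walk (shift t x)) (N - t) = ((Finset.range (N - t)).filter
        (fun j => walk x (t + (j + 1)) = y ∨ walk x (t + (j + 1)) = z)).card := by
    intro v hv
    unfold pairVisits
    congr 1
    refine Finset.filter_congr fun j _ => ?_
    rw [walk_add x t, hv]
  rcases hw with h | h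
  · refine ⟨z - y, Or.inl rfl, N - t, ?_⟩
    rw [hvis]
    · omega
    · intro u
      rw [h, add_eq_left, eq_sub_iff_add_eq, add_comm]
  · refine ⟨y - z, Or.inr rfl, N - t, ?_⟩
    rw [hvis]
    · omega
    · intro u
      rw [h, add_eq_left, eq_sub_iff_add_eq, add_comm, or_comm]

end FirstVisit

/-! ### Growth of the maximal local time and separation of favorites -/

section Growth

variable {d : ℕ}

/-- The probability that the walk returns to its starting point within `L` steps. -/
noncomputable def returnProbBy (d L : ℕ) : ℝ :=
  (walkLaw d).real {x | ∃ n < L, walk x (n + 1) = 0}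

theorem measurableSet_returnBy (L : ℕ) :
    MeasurableSet {x : ℕ → Fin d → ℤ | ∃ n < L, walk x (n + 1) = 0} :=
  measurableSet_walk L (F := fun w => ∃ n < L, w (n + 1) = 0) fun w w' h =>
    propext <| exists_congr fun n => and_congr_right fun hn => by rw [h (n + 1) hn]

theorem tendsto_returnProbBy (d : ℕ) [NeZero d] :
    Tendsto (returnProbBy d) atTop (nhds (returnProb d)) := by
  have h := tendsto_measureReal_exists_le (walkLaw d) fun n x => walk x (n + 1) = 0
  rw [← tendsto_add_atTop_iff_nat 1]
  refine h.congr fun n => ?_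
  simp only [returnProbBy, Nat.lt_succ_iff]

/-- Chain i returns to the origin, each made within L steps of the previous one. -/
theorem returnProbBy_pow_le [NeZero d] (L i : ℕ) :
    returnProbBy d L ^ i ≤ (walkLaw d).real
      {x | ∃ t, t ≤ i * L ∧ walk x t = 0 ∧ i + 1 ≤ localTime (walk x) 0 t} := by
  induction i with
  | zero =>
    have : {x : ℕ → Fin d → ℤ | ∃ t, t ≤ 0 * L ∧ walk x t = 0 ∧ 0 + 1 ≤ localTime (walk x) 0 t} =
        Set.univ := by
      refine Set.eq_univ_of_forall fun x => ⟨0, by simp, by simp, ?_⟩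
      simp [localTime_zero]
    rw [this]; simp
  | succ i ih =>
    have hτ : ∀ t, DependsOn (fun x : ℕ → Fin d → ℤ =>
        t ≤ i * L ∧ walk x t = 0 ∧ i + 1 ≤ localTime (walk x) 0 t) (Set.Iio t) := fun t =>
      dependsOn_of_walk t (F := fun w => t ≤ i * L ∧ w t = 0 ∧ i + 1 ≤ localTime w 0 t)
        fun w w' h => by rw [h t le_rfl, localTime_congr h]
    rw [pow_succ']
    refine (mul_le_mul_of_nonneg_left ih measureReal_nonneg).trans
      ((le_walkLaw_stage hτ (Q := fun _ _ => {x | ∃ n < L, walk x (n + 1) = 0})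
      (fun _ _ _ _ => rfl) (fun _ _ => measurableSet_returnBy L) measureReal_nonneg
      (fun _ _ _ => le_rfl)).trans (measureReal_mono ?_))
    rintro x ⟨t, ⟨⟨h1, h2, h3⟩, _⟩, n, hn, hw⟩
    have hw' : walk x (t + n + 1) = 0 := by rw [add_assoc, walk_add, h2, hw, zero_add]
    refine ⟨t + n + 1, ?_, hw', ?_⟩
    · rw [Nat.succ_mul]; omega
    · rw [localTime_succ, if_pos hw']
      have := localTime_mono (walk x) 0 (show t ≤ t + n by omega)
      omega

theorem returnProbBy_pow_le_localTime [NeZero d] (L k : ℕ) :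
    returnProbBy d L ^ k ≤ (walkLaw d).real {x | k + 1 ≤ localTime (walk x) 0 (k * L)} :=
  (returnProbBy_pow_le L k).trans (measureReal_mono fun x ⟨_, h1, _, h3⟩ =>
    h3.trans (localTime_mono (walk x) 0 h1))

theorem localTime_shift_le (x : ℕ → Fin d → ℤ) (t n : ℕ) (y : Fin d → ℤ) :
    localTime (walk (shift t x)) y n ≤ localTime (walk x) (walk x t + y) (t + n) := by
  unfold localTime
  refine Finset.card_le_card_of_injOn (fun j => t + j) ?_ fun a _ b _ h => Nat.add_left_cancel h
  intro j hj
  simp only [Finset.coe_filter, Finset.mem_range, Set.mem_ofPred_eq] at hj ⊢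
  exact ⟨by omega, by rw [walk_add, hj.2]⟩

theorem walk_shift_congr {x y : ℕ → Fin d → ℤ} {s n N : ℕ} (hN : s + n ≤ N)
    (h : ∀ i ∈ Set.Iio N, x i = y i) : ∀ m ≤ n, walk (shift s x) m = walk (shift s y) m := by
  intro m hm
  refine walk_congr (n := n) (fun i hi => h (s + i) ?_) hm
  have : i < n := hi
  exact lt_of_lt_of_le (by omega) hN

/-- Cut time into j independent blocks of length k L. In each block the initial site collects k + 1
visits with probability at least that of k successive quick returns. -/
theorem walkLaw_maxLocalTime_le [NeZero d] (L k j : ℕ) :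
    (walkLaw d).real {x | maxLocalTime (walk x) (j * (k * L)) ≤ k} ≤
      (1 - returnProbBy d L ^ k) ^ j := by
  set B := k * L
  have hY : MeasurableSet {x : ℕ → Fin d → ℤ | k + 1 ≤ localTime (walk x) 0 B} :=
    measurableSet_walk B (F := fun w => k + 1 ≤ localTime w 0 B) fun w w' h => by
      rw [localTime_congr h]
  have h1 : (walkLaw d).real {x : ℕ → Fin d → ℤ | k + 1 ≤ localTime (walk x) 0 B}ᶜ ≤
      1 - returnProbBy d L ^ k := by
    rw [probReal_compl_eq_one_sub hY]
    have := returnProbBy_pow_le_localTime (d := d) L k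
    linarith
  have key : (walkLaw d).real
      {x | ∀ b < j, ¬ (k + 1 ≤ localTime (walk (shift (b * B) x)) 0 B)} ≤
        (1 - returnProbBy d L ^ k) ^ j := by
    induction j with
    | zero => simp
    | succ j ih =>
      have hdep : DependsOn (fun x : ℕ → Fin d → ℤ => ∀ b < j,
          ¬ (k + 1 ≤ localTime (walk (shift (b * B) x)) 0 B)) (Set.Iio (j * B)) := by
        intro x y h
        refine propext (forall₂_congr fun b hb => ?_)
        have : b * B + B ≤ j * B := by
          rw [← Nat.succ_mul]; exact Nat.mul_le_mul_right _ hb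
        rw [localTime_congr (walk_shift_congr this h)]
      have := walkLaw_real_and_shift_mem_le hdep hY.compl
      rw [pow_succ']
      refine le_trans (measureReal_mono ?_) (this.trans
        (mul_le_mul h1 ih measureReal_nonneg (measureReal_nonneg.trans h1)))
      intro x hx
      exact ⟨fun b hb => hx b (by omega), hx j (by omega)⟩
  refine (measureReal_mono ?_).trans key
  intro x hx b hb hcon
  have h2 := localTime_shift_le x (b * B) B 0
  have h3 : b * B + B ≤ j * B := by
    rw [← Nat.succ_mul]; exact Nat.mul_le_mul_right _ hb
  have h4 := localTime_mono (walk x) (walk x (b * B) + 0) h3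
  have h5 := localTime_le_maxLocalTime (walk x) (walk x (b * B) + 0) (j * B)
  have h6 : maxLocalTime (walk x) (j * B) ≤ k := hx
  omega

theorem measurableSet_exists_pairVisits (v : Fin d → ℤ) (m : ℕ) :
    MeasurableSet {x : ℕ → Fin d → ℤ | ∃ n, m ≤ pairVisits v (walk x) n} :=
  measurableSet_exists_of_dependsOn fun n =>
    ⟨n, dependsOn_of_walk n (F := fun w => m ≤ pairVisits v w n) fun w w' h => by
      rw [pairVisits_congr v h]⟩

theorem walkLaw_shift_pairVisits_le [NeZero d] (v : Fin d → ℤ) (m t : ℕ) :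
    (walkLaw d).real {x | ∃ n, m ≤ pairVisits v (walk (shift t x)) n} ≤
      pairReturnProb d v ^ m := by
  have h := walkLaw_real_and_shift_mem_le (t := t) (σ := fun _ => True) (fun _ _ _ => rfl)
    (measurableSet_exists_pairVisits v m)
  simp only [true_and, Set.ofPred_true, probReal_univ, mul_one] at h
  exact h.trans (walkLaw_pairVisits_le v m)

/-- Union bound over the time of the first visit to a favorite site, after which k - 1 returns must
follow. -/
theorem walkLaw_le_maxLocalTime_le [NeZero d] {k : ℕ} (hk : 1 ≤ k) (N : ℕ) :
    (walkLaw d).real {x | k ≤ maxLocalTime (walk x) N} ≤ (N + 1) * returnProb d ^ (k - 1) := by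
  calc _ ≤ (walkLaw d).real (⋃ t ∈ Finset.range (N + 1),
        {x | ∃ n, k - 1 ≤ pairVisits 0 (walk (shift t x)) n}) := by
        refine measureReal_mono ?_ (measure_ne_top _ _)
        intro x hx
        obtain ⟨y, hy⟩ := exists_mem_favoriteSites (walk x) N
        obtain ⟨t, ht, h⟩ := exists_pairVisits_of_localTime hk
          (le_of_le_of_eq hx (show localTime (walk x) y N = _ from hy).symm)
        exact Set.mem_biUnion (Finset.mem_coe.2 (Finset.mem_range.2 (by omega))) h
    _ ≤ ∑ t ∈ Finset.range (N + 1),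
        (walkLaw d).real {x | ∃ n, k - 1 ≤ pairVisits 0 (walk (shift t x)) n} :=
        measureReal_biUnion_finset_le _ _
    _ ≤ ∑ t ∈ Finset.range (N + 1), returnProb d ^ (k - 1) := by
        refine Finset.sum_le_sum fun t _ => ?_
        rw [← pairReturnProb_zero]
        exact walkLaw_shift_pairVisits_le 0 _ t
    _ = _ := by simp

/-- Some level-`k` set of favorite sites contains two sites at distance at most `k`. -/
def CloseFavorites (k : ℕ) : Set (ℕ → Fin d → ℤ) :=
  {x | ∃ n, maxLocalTime (walk x) n = k ∧ ¬ Separated k (favoriteSites (walk x) n)}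

/-- Either level k has not been passed by time N, or a close pair was completed before N. The latter
is a union over the first visit time and over the displacement of the pair, which lies in a box of
side 2k + 1. -/
theorem walkLaw_closeFavorites_le [NeZero d] {ρ : ℝ}
    (hρ : ∀ z : Fin d → ℤ, z ≠ 0 → pairReturnProb d z ^ 2 ≤ ρ) {k : ℕ} (hk : 1 ≤ k) (N : ℕ) :
    (walkLaw d).real (CloseFavorites k) ≤ (walkLaw d).real {x | maxLocalTime (walk x) N ≤ k} +
      (N + 1) * (2 * k + 1) ^ d * ρ ^ (k - 1) := by
  classical
  let box : Finset (Fin d → ℤ) :=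
    (Fintype.piFinset fun _ : Fin d => Finset.Icc (-(k : ℤ)) k).erase 0
  have hcard : (box.card : ℝ) ≤ (2 * k + 1) ^ d := by
    have h1 : box.card ≤ (2 * k + 1) ^ d := by
      refine (Finset.card_erase_le).trans (le_of_eq ?_)
      rw [Fintype.card_piFinset_const, Int.card_Icc]
      congr 1; omega
    exact_mod_cast h1
  have hsub : CloseFavorites k ⊆ {x : ℕ → Fin d → ℤ | maxLocalTime (walk x) N ≤ k} ∪
      ⋃ p ∈ Finset.range (N + 1) ×ˢ box,
        {x | ∃ n, 2 * k - 1 ≤ pairVisits p.2 (walk (shift p.1 x)) n} := by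
    rintro x ⟨n, hn, hsep⟩
    by_cases hnN : N ≤ n
    · exact Or.inl (hn ▸ maxLocalTime_mono (walk x) hnN)
    right
    unfold Separated at hsep
    push Not at hsep
    obtain ⟨y, hy, z, hz, hne, hclose⟩ := hsep
    obtain ⟨t, ht, v, hv, hvis⟩ := exists_pairVisits_of_localTime_pair hk hne
      (le_of_eq ((show localTime (walk x) y n = _ from hy).trans hn).symm)
      (le_of_eq ((show localTime (walk x) z n = _ from hz).trans hn).symm)
    have hbox : v ∈ box := by
      rw [Finset.mem_erase, Fintype.mem_piFinset]
      rcases hv with rfl | rfl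
      · refine ⟨sub_ne_zero.2 hne.symm, fun i => ?_⟩
        have := abs_le.1 (hclose i)
        simp only [Pi.sub_apply, Finset.mem_Icc]
        omega
      · refine ⟨sub_ne_zero.2 hne, fun i => ?_⟩
        have := abs_le.1 (hclose i)
        simp only [Pi.sub_apply, Finset.mem_Icc]
        omega
    refine Set.mem_biUnion (x := (t, v)) ?_ hvis
    rw [Finset.mem_coe, Finset.mem_product]
    exact ⟨Finset.mem_range.2 (by omega), hbox⟩
  refine (measureReal_mono hsub).trans ((measureReal_union_le _ _).trans
    (add_le_add_right ?_ _))
  have hρ0 : 0 ≤ ρ := by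
    refine le_trans (sq_nonneg _) (hρ (Pi.single ⟨0, Nat.pos_of_ne_zero (NeZero.ne d)⟩ 1) ?_)
    simp
  calc _ ≤ ∑ p ∈ Finset.range (N + 1) ×ˢ box, (walkLaw d).real
        {x | ∃ n, 2 * k - 1 ≤ pairVisits p.2 (walk (shift p.1 x)) n} :=
        measureReal_biUnion_finset_le _ _
    _ ≤ ∑ p ∈ Finset.range (N + 1) ×ˢ box, ρ ^ (k - 1) := by
        refine Finset.sum_le_sum fun p hp => ?_
        have hp0 : p.2 ≠ 0 := Finset.ne_of_mem_erase (Finset.mem_product.1 hp).2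
        refine (walkLaw_shift_pairVisits_le p.2 _ p.1).trans ?_
        calc pairReturnProb d p.2 ^ (2 * k - 1) ≤ pairReturnProb d p.2 ^ (2 * (k - 1)) :=
              pow_le_pow_of_le_one measureReal_nonneg measureReal_le_one (by omega)
          _ = (pairReturnProb d p.2 ^ 2) ^ (k - 1) := pow_mul _ _ _
          _ ≤ _ := by
              gcongr
              exact hρ _ hp0
    _ = (N + 1) * box.card * ρ ^ (k - 1) := by simp [Finset.card_product]
    _ ≤ _ := by gcongr

theorem ae_eventually_notMem_of_summable {α : Type*} [MeasurableSpace α] (μ : Measure α)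
    [IsFiniteMeasure μ] {s : ℕ → Set α} {f : ℕ → ℝ} (hf : Summable f)
    (h : ∀ᶠ k in atTop, μ.real (s k) ≤ f k) : ∀ᵐ x ∂μ, ∀ᶠ k in atTop, x ∉ s k := by
  obtain ⟨K, hK⟩ := eventually_atTop.1 h
  have h1 : Summable fun k => μ.real (s (k + K)) :=
    Summable.of_nonneg_of_le (fun _ => measureReal_nonneg) (fun k => hK _ (by omega))
      ((summable_nat_add_iff K).2 hf)
  have h2 : ∑' k, μ (s (k + K)) ≠ ⊤ := by
    have e : ∀ k, μ (s (k + K)) = ENNReal.ofReal (μ.real (s (k + K))) := fun k =>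
      (ofReal_measureReal).symm
    simp only [e]
    exact h1.tsum_ofReal_ne_top
  filter_upwards [ae_eventually_notMem h2] with x hx
  obtain ⟨M, hM⟩ := eventually_atTop.1 hx
  refine eventually_atTop.2 ⟨M + K, fun k hk => ?_⟩
  have := hM (k - K) (by omega)
  rwa [Nat.sub_add_cancel (by omega)] at this

theorem exists_pairReturnProb_sq_le_lt (hd : 3 ≤ d) : ∃ ρ, 0 < ρ ∧ ρ < returnProb d ∧
    ∀ z : Fin d → ℤ, z ≠ 0 → pairReturnProb d z ^ 2 ≤ ρ := by
  have : NeZero d := ⟨by omega⟩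
  obtain ⟨η, hη, h⟩ := exists_pairReturnProb_sq_le hd
  have hq := returnProb_pos (d := d)
  refine ⟨returnProb d - min η (returnProb d / 2), ?_, ?_, fun z hz => (h z hz).trans ?_⟩
  · have := min_le_right η (returnProb d / 2); linarith
  · have : 0 < min η (returnProb d / 2) := by positivity
    linarith
  · have := min_le_left η (returnProb d / 2); linarith

/-- Almost surely, at all high levels the favorite sites are far apart and the level is exceeded
after an at most exponential time. -/
theorem ae_eventually_level (hd : 3 ≤ d) :
    ∃ C : ℝ, 0 < C ∧ ∀ᵐ x ∂(walkLaw d), ∀ᶠ k : ℕ in atTop,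
      x ∉ CloseFavorites k ∧ ∃ N : ℕ, (N : ℝ) ≤ Real.exp (C * k) ∧ k < maxLocalTime (walk x) N := by
  have : NeZero d := ⟨by omega⟩
  obtain ⟨ρ, hρ0, hρq, hρ⟩ := exists_pairReturnProb_sq_le_lt hd
  -- A finite horizon L puts θ strictly above ρ. A time of order θ^(-k), up to powers of k, then
  -- suffices to pass level k, while close pairs cost (ρ / θ)^k up to powers of k.
  obtain ⟨L, hL⟩ := ((tendsto_returnProbBy d).eventually_const_lt hρq).exists
  set θ := returnProbBy d L with hθdef
  have hθ0 : 0 < θ := hρ0.trans hL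
  have hθ1 : θ ≤ 1 := measureReal_le_one
  have hL0 : (1 : ℝ) ≤ L := by
    rcases Nat.eq_zero_or_pos L with h | h
    · subst h; simp [hθdef, returnProbBy] at hθ0
    · exact_mod_cast h
  -- With this many blocks, each succeeding with probability at least θ^k, the failure probability
  -- is at most e^(-k).
  let j : ℕ → ℕ := fun k => ⌈(k : ℝ) * (θ⁻¹) ^ k⌉₊
  let N : ℕ → ℕ := fun k => j k * (k * L)
  have hinv : 1 ≤ θ⁻¹ := (one_le_inv₀ hθ0).2 hθ1
  have hj : ∀ k : ℕ, 1 ≤ k → (j k : ℝ) ≤ 2 * k * (θ⁻¹) ^ k := fun k hk => by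
    have h1 := (Nat.ceil_lt_add_one (show 0 ≤ (k : ℝ) * (θ⁻¹) ^ k by positivity)).le
    have hk' : (1 : ℝ) ≤ k := by exact_mod_cast hk
    have h2 : 1 ≤ (k : ℝ) * (θ⁻¹) ^ k := one_le_mul_of_one_le_of_one_le hk' (one_le_pow₀ hinv)
    calc (j k : ℝ) ≤ _ := h1
      _ ≤ 2 * k * (θ⁻¹) ^ k := by linarith
  have hN : ∀ k : ℕ, 1 ≤ k → (N k : ℝ) ≤ 2 * L * (k : ℝ) ^ 2 * (θ⁻¹) ^ k := fun k hk => by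
    simp only [N]
    push_cast
    calc (j k : ℝ) * (k * L) ≤ 2 * k * (θ⁻¹) ^ k * (k * L) := by gcongr; exact hj k hk
      _ = _ := by ring
  have hmax : ∀ k : ℕ, (walkLaw d).real {x | maxLocalTime (walk x) (N k) ≤ k} ≤
      Real.exp (-1) ^ k := fun k => by
    refine (walkLaw_maxLocalTime_le L k (j k)).trans ?_
    have h1 : 1 - θ ^ k ≤ Real.exp (- θ ^ k) := by
      have := Real.add_one_le_exp (- θ ^ k); linarith
    have h0 : 0 ≤ 1 - θ ^ k := by
      have := pow_le_one₀ (n := k) hθ0.le hθ1; linarith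
    calc (1 - θ ^ k) ^ j k ≤ (Real.exp (- θ ^ k)) ^ j k := by gcongr
      _ = Real.exp (- (j k * θ ^ k)) := by rw [← Real.exp_nat_mul]; ring_nf
      _ ≤ Real.exp (- k) := by
          apply Real.exp_le_exp.2
          have h2 : (k : ℝ) * (θ⁻¹) ^ k ≤ j k := Nat.le_ceil _
          have h3 : (k : ℝ) * (θ⁻¹) ^ k * θ ^ k ≤ j k * θ ^ k := by gcongr
          rw [mul_assoc, ← mul_pow, inv_mul_cancel₀ hθ0.ne', one_pow, mul_one] at h3
          linarith
      _ = _ := by rw [← Real.exp_nat_mul]; ring_nf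
  have hexp1 : Real.exp (-1) < 1 := by simp
  have hS1 : Summable fun k : ℕ => Real.exp (-1) ^ k :=
    summable_geometric_of_lt_one (Real.exp_pos _).le hexp1
  have hr : ‖ρ / θ‖ < 1 := by
    rw [Real.norm_of_nonneg (by positivity), div_lt_one hθ0]; exact hL
  have hS2 : Summable fun k : ℕ => Real.exp (-1) ^ k +
      3 * L * 3 ^ d / ρ * ((k : ℝ) ^ (2 + d) * (ρ / θ) ^ k) :=
    hS1.add ((summable_pow_mul_geometric_of_norm_lt_one (2 + d) hr).mul_left _)
  have hclose : ∀ᶠ k : ℕ in atTop, (walkLaw d).real (CloseFavorites k) ≤ Real.exp (-1) ^ k +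
      3 * L * 3 ^ d / ρ * ((k : ℝ) ^ (2 + d) * (ρ / θ) ^ k) := by
    filter_upwards [eventually_ge_atTop 1] with k hk
    refine (walkLaw_closeFavorites_le hρ hk (N k)).trans (add_le_add (hmax k) ?_)
    have hk' : (1 : ℝ) ≤ k := by exact_mod_cast hk
    have h1 : (N k : ℝ) + 1 ≤ 3 * L * (k : ℝ) ^ 2 * (θ⁻¹) ^ k := by
      have h2 : 1 ≤ L * (k : ℝ) ^ 2 * (θ⁻¹) ^ k :=
        one_le_mul_of_one_le_of_one_le
          (one_le_mul_of_one_le_of_one_le hL0 (one_le_pow₀ hk')) (one_le_pow₀ hinv)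
      have := hN k hk
      linarith
    have h3 : ρ ^ (k - 1) = ρ ^ k / ρ := by
      rw [eq_div_iff hρ0.ne', ← pow_succ, Nat.sub_add_cancel hk]
    calc _ ≤ 3 * L * (k : ℝ) ^ 2 * (θ⁻¹) ^ k * (3 * k) ^ d * ρ ^ (k - 1) := by
          gcongr; linarith
      _ = _ := by
          rw [h3, div_pow ρ θ, inv_pow, mul_pow 3 (k : ℝ), pow_add]
          field_simp
  refine ⟨Real.log (θ⁻¹) + 2 + 2 * L, ?_, ?_⟩
  · have := Real.log_nonneg hinv
    linarith
  filter_upwards [ae_eventually_notMem_of_summable _ hS1 (Eventually.of_forall hmax),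
    ae_eventually_notMem_of_summable _ hS2 hclose] with x hx1 hx2
  filter_upwards [hx1, hx2, eventually_ge_atTop 1] with k h1 h2 hk
  refine ⟨h2, N k, (hN k hk).trans ?_, not_le.1 h1⟩
  have hk' : (1 : ℝ) ≤ k := by exact_mod_cast hk
  have e1 : (θ⁻¹) ^ k = Real.exp (Real.log θ⁻¹ * k) := by
    rw [mul_comm, Real.exp_nat_mul, Real.exp_log (by positivity)]
  have e2 : (k : ℝ) ^ 2 ≤ Real.exp (2 * k) := by
    have : (k : ℝ) ≤ Real.exp k := by have := Real.add_one_le_exp (k : ℝ); linarith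
    calc (k : ℝ) ^ 2 ≤ (Real.exp k) ^ 2 := by gcongr
      _ = _ := by rw [← Real.exp_nat_mul]; norm_num
  have e3 : 2 * (L : ℝ) ≤ Real.exp (2 * L * k) := by
    have := Real.add_one_le_exp (2 * (L : ℝ) * k)
    nlinarith
  calc _ ≤ Real.exp (2 * L * k) * Real.exp (2 * k) * Real.exp (Real.log θ⁻¹ * k) := by
        rw [e1]; gcongr
    _ = _ := by rw [← Real.exp_add, ← Real.exp_add]; ring_nf

/-- Almost surely, high levels are reached only after an exponential time. -/
theorem ae_eventually_exp_le (hd : 3 ≤ d) :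
    ∃ c : ℝ, 0 < c ∧ ∀ᵐ x ∂(walkLaw d), ∀ᶠ k : ℕ in atTop,
      ∀ n : ℕ, maxLocalTime (walk x) n = k → Real.exp (c * k) ≤ n := by
  have : NeZero d := ⟨by omega⟩
  set q := returnProb d with hq
  have hq0 : 0 < q := returnProb_pos
  have hq1 : q < 1 := (returnProb_le_hitBound hd).trans_lt hitBound_lt_one
  -- For the time r^(-k) the union bound costs r^(-k) q^k = r^k, which is summable.
  set r := Real.sqrt q with hr
  have hr0 : 0 < r := Real.sqrt_pos.2 hq0
  have hr1 : r < 1 := by rw [hr, Real.sqrt_lt' one_pos]; simpa using hq1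
  have hrq : r * r = q := Real.mul_self_sqrt hq0.le
  have hc : 0 < Real.log r⁻¹ := Real.log_pos ((one_lt_inv₀ hr0).2 hr1)
  have he : ∀ k : ℕ, Real.exp (Real.log r⁻¹ * k) = (r⁻¹) ^ k := fun k => by
    rw [mul_comm, Real.exp_nat_mul, Real.exp_log (by positivity)]
  refine ⟨Real.log r⁻¹, hc, ?_⟩
  have hS : Summable fun k : ℕ => 2 / q * r ^ k :=
    (summable_geometric_of_lt_one hr0.le hr1).mul_left _
  have hb : ∀ᶠ k : ℕ in atTop, (walkLaw d).real
      {x | k ≤ maxLocalTime (walk x) ⌊Real.exp (Real.log r⁻¹ * k)⌋₊} ≤ 2 / q * r ^ k := by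
    filter_upwards [eventually_ge_atTop 1] with k hk
    refine (walkLaw_le_maxLocalTime_le hk _).trans ?_
    have h1 : (⌊Real.exp (Real.log r⁻¹ * k)⌋₊ : ℝ) + 1 ≤ 2 * (r⁻¹) ^ k := by
      have h2 := Nat.floor_le (Real.exp_pos (Real.log r⁻¹ * k)).le
      rw [he] at h2 ⊢
      have h3 : 1 ≤ (r⁻¹) ^ k := one_le_pow₀ ((one_le_inv₀ hr0).2 hr1.le)
      linarith
    have h3 : q ^ (k - 1) = q ^ k / q := by
      rw [eq_div_iff hq0.ne', ← pow_succ, Nat.sub_add_cancel hk]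
    calc _ ≤ 2 * (r⁻¹) ^ k * q ^ (k - 1) := by gcongr
      _ = _ := by
        rw [h3, ← hrq, mul_pow, inv_pow]
        field_simp
  filter_upwards [ae_eventually_notMem_of_summable _ hS hb] with x hx
  filter_upwards [hx] with k hk n hn
  by_contra hcon
  push Not at hcon
  apply hk
  have : n ≤ ⌊Real.exp (Real.log r⁻¹ * k)⌋₊ := Nat.le_floor hcon.le
  exact hn.symm.le.trans (maxLocalTime_mono (walk x) this)

end Growth

/-! ### Upper bound for the number of favorites at a level -/

section Upper

variable {d : ℕ} {w : ℕ → Fin d → ℤ}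

theorem exists_visit_of_localTime_lt {y : Fin d → ℤ} {t n : ℕ}
    (h : localTime w y t < localTime w y n) : ∃ j, t < j ∧ j ≤ n ∧ w j = y := by
  by_contra hcon
  push Not at hcon
  refine absurd h (not_lt.2 ?_)
  unfold localTime
  refine Finset.card_le_card fun j hj => ?_
  rw [Finset.mem_filter, Finset.mem_range] at hj ⊢
  refine ⟨?_, hj.2⟩
  by_contra hjt
  exact hcon j (by omega) (by omega) hj.2

theorem abs_sub_le_of_unit_steps (hw : ∀ n i, |w (n + 1) i - w n i| ≤ 1) (t n : ℕ) (i : Fin d) :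
    |w (t + n) i - w t i| ≤ n := by
  induction n with
  | zero => simp
  | succ n ih =>
    have h1 := abs_le.1 (hw (t + n) i)
    have h2 := abs_le.1 ih
    rw [← add_assoc, abs_le]
    push_cast
    constructor <;> omega

/-- While the favorite sites stay separated, the walk must avoid the current favorite site for a
while before the number of favorite sites can increase. -/
theorem exists_firstAt_of_favoriteState_succ (hw : ∀ n i, |w (n + 1) i - w n i| ≤ 1)
    {k i m n : ℕ} (hi : 1 ≤ i) (hn : FavoriteState w k (i + 1) n)
    (hsep : Separated m (favoriteSites w n)) :
    ∃ t, FirstAt (fun t w => FavoriteState w k i t ∧ Separated m (favoriteSites w t)) t w ∧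
      ∀ j < m, w (t + (j + 1)) ≠ w t := by
  obtain ⟨s, hsn, hs⟩ := exists_favoriteState_pred hi hn
  have hss : Separated m (favoriteSites w s) :=
    hsep.subset (favoriteSites_subset hsn.le (hs.1.trans hn.1.symm))
  obtain ⟨t, ht⟩ := exists_firstAt
    (τ := fun t w => FavoriteState w k i t ∧ Separated m (favoriteSites w t)) (x := w) ⟨s, hs, hss⟩
  refine ⟨t, ht, fun j hj hret => ?_⟩
  have hmem : w t ∈ favoriteSites w t := mem_favoriteSites_of_first ht.1.1 fun r hr hrs =>
    ht.2 r hr ⟨hrs, hrs.favoriteSites_eq ht.1.1 ▸ ht.1.2⟩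
  have hts : t ≤ s := by
    by_contra h
    exact ht.2 s (by omega) ⟨hs, hss⟩
  have hmax : maxLocalTime w t = maxLocalTime w n := ht.1.1.1.trans hn.1.symm
  have hsub := favoriteSites_subset (hts.trans hsn.le) hmax
  -- A return to the favorite `w t` raises the level, hence it comes after time n.
  have hlt : n < t + (j + 1) := by
    by_contra h
    exact notMem_favoriteSites_of_lt (by omega) (not_lt.1 h) hmax (hret ▸ hmem)
  obtain ⟨y, hy, hyt⟩ := Set.exists_mem_notMem_of_ncard_lt_ncard
    (show (favoriteSites w t).ncard < (favoriteSites w n).ncard by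
      rw [ht.1.1.2, hn.2]; omega) (finite_favoriteSites w t)
  have hylt : localTime w y t < localTime w y n := by
    have h1 : localTime w y n = maxLocalTime w n := hy
    have h2 : localTime w y t ≠ maxLocalTime w t := hyt
    have h3 := localTime_le_maxLocalTime w y t
    omega
  obtain ⟨l, htl, hln, hwl⟩ := exists_visit_of_localTime_lt hylt
  -- The new favorite y is more than m away from `w t`, yet it is visited fewer than m steps after
  -- t.
  obtain ⟨c, hc⟩ := hsep y hy (w t) (hsub hmem) fun h => hyt (h ▸ hmem)
  have h1 := abs_sub_le_of_unit_steps hw t (l - t) c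
  rw [show t + (l - t) = l by omega, hwl] at h1
  omega

theorem abs_walk_succ_sub_le {x : ℕ → Fin d → ℤ}
    (hx : ∀ n, ∃ (i : Fin d) (s : ℤˣ), x n = Pi.single i (s : ℤ)) (n : ℕ) (i : Fin d) :
    |walk x (n + 1) i - walk x n i| ≤ 1 := by
  obtain ⟨j, s, h⟩ := hx n
  rw [walk_succ, h]
  simp only [Pi.add_apply, add_sub_cancel_left]
  by_cases hij : i = j
  · subst hij
    rcases Int.units_eq_one_or s with rfl | rfl <;> simp
  · simp [hij]

/-- At the first time of each stage the walk must fail to return within m steps, which is an event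
of the future alone; so every favorite after the first costs one factor. -/
theorem walkLaw_favoriteState_separated_le [NeZero d] (k m i : ℕ) :
    (walkLaw d).real {x | ∃ n, FavoriteState (walk x) k (i + 1) n ∧
      Separated m (favoriteSites (walk x) n)} ≤ (1 - returnProbBy d m) ^ i := by
  induction i with
  | zero => simp
  | succ i ih =>
    have hτ : ∀ t, DependsOn (fun x : ℕ → Fin d → ℤ => FavoriteState (walk x) k (i + 1) t ∧
        Separated m (favoriteSites (walk x) t)) (Set.Iio t) := fun t =>
      dependsOn_of_walk t (F := fun w => FavoriteState w k (i + 1) t ∧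
        Separated m (favoriteSites w t)) fun w w' h => by
          rw [favoriteState_congr h, favoriteSites_congr h]
    have hm := measurableSet_returnBy (d := d) m
    have hp : (walkLaw d).real {x : ℕ → Fin d → ℤ | ∃ n < m, walk x (n + 1) = 0}ᶜ =
        1 - returnProbBy d m := probReal_compl_eq_one_sub hm
    have key := walkLaw_stage_le hτ (Q := fun _ _ => {x | ∃ n < m, walk x (n + 1) = 0}ᶜ)
      (fun _ _ _ _ => rfl) (fun _ _ => hm.compl) measureReal_nonneg (fun _ _ _ => le_rfl)
    rw [hp] at key
    have hnn : 0 ≤ 1 - returnProbBy d m := hp ▸ measureReal_nonneg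
    rw [pow_succ']
    refine le_trans ?_ (key.trans (mul_le_mul_of_nonneg_left ih hnn))
    -- The inclusion needs unit steps, which hold only almost surely.
    refine ENNReal.toReal_mono (measure_ne_top _ _) (measure_mono_ae ?_)
    filter_upwards [ae_exists_unit_step (d := d)] with x hx
    rintro ⟨n, hn, hsep⟩
    obtain ⟨t, ht, h⟩ := exists_firstAt_of_favoriteState_succ (abs_walk_succ_sub_le hx)
      (by omega) hn hsep
    refine ⟨t, ht, ?_⟩
    rintro ⟨j, hj, hret⟩
    apply h j hj
    rw [walk_add, hret, add_zero]

theorem exists_favoriteState_of_le {k i n : ℕ} (hi : 1 ≤ i) (hk : maxLocalTime w n = k)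
    (hn : i ≤ (favoriteSites w n).ncard) : ∃ t ≤ n, FavoriteState w k i t := by
  obtain ⟨l, hl⟩ := Nat.exists_eq_add_of_le hn
  induction l generalizing n with
  | zero => exact ⟨n, le_rfl, hk, hl⟩
  | succ l ih =>
    obtain ⟨t, htn, ht⟩ := exists_favoriteState_pred (i := i + l) (by omega) ⟨hk, hl⟩
    obtain ⟨s, hs, h⟩ := ih ht.1 (by rw [ht.2]; omega) ht.2
    exact ⟨s, hs.trans htn.le, h⟩

/-- First Borel–Cantelli lemma: the level-k bound is a power of k with exponent a log g, and the
strict inequality for a lets a finite horizon m keep this exponent below -1. Separation by k,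
eventually automatic, gives separation by m once k ≥ m. -/
theorem ae_eventually_ncard_lt (hd : 3 ≤ d) {a : ℝ} (ha : -1 / Real.log (1 - returnProb d) < a) :
    ∀ᵐ x ∂(walkLaw d), ∀ᶠ k : ℕ in atTop, ∀ n, maxLocalTime (walk x) n = k →
      ((favoriteSites (walk x) n).ncard : ℝ) < a * Real.log k := by
  have : NeZero d := ⟨by omega⟩
  have hq0 := returnProb_pos (d := d)
  have hq1 : returnProb d < 1 := (returnProb_le_hitBound hd).trans_lt hitBound_lt_one
  set γ := 1 - returnProb d with hγ
  have hγ0 : 0 < γ := by linarith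
  have hlog : Real.log γ < 0 := Real.log_neg hγ0 (by linarith)
  have ha0 : 0 < a := lt_trans (div_pos_of_neg_of_neg (by norm_num) hlog) ha
  have ha1 : a * Real.log γ < -1 := by rwa [div_lt_iff_of_neg hlog] at ha
  obtain ⟨m, hm⟩ : ∃ m, a * Real.log (1 - returnProbBy d m) < -1 := by
    have h1 : Tendsto (fun m => a * Real.log (1 - returnProbBy d m)) atTop
        (nhds (a * Real.log γ)) :=
      ((tendsto_const_nhds.sub (tendsto_returnProbBy d)).log hγ0.ne').const_mul a
    exact (h1.eventually_lt_const ha1).exists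
  set g := 1 - returnProbBy d m with hg
  have hg0 : 0 < g := by
    have : returnProbBy d m ≤ returnProb d := measureReal_mono fun x ⟨n, _, h⟩ => ⟨n, h⟩
    linarith
  have hg1 : g ≤ 1 := by
    have : 0 ≤ returnProbBy d m := measureReal_nonneg
    linarith
  let j : ℕ → ℕ := fun k => ⌈a * Real.log k⌉₊
  have hj : ∀ k : ℕ, 2 ≤ k → 1 ≤ j k := fun k hk => by
    refine Nat.one_le_ceil_iff.2 (mul_pos ha0 (Real.log_pos ?_))
    exact_mod_cast hk
  have hS : Summable fun k : ℕ => g⁻¹ * (k : ℝ) ^ (a * Real.log g) :=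
    (Real.summable_nat_rpow.2 hm).mul_left _
  have hb : ∀ᶠ k : ℕ in atTop, (walkLaw d).real {x | ∃ n, FavoriteState (walk x) k (j k) n ∧
      Separated m (favoriteSites (walk x) n)} ≤ g⁻¹ * (k : ℝ) ^ (a * Real.log g) := by
    filter_upwards [eventually_ge_atTop 2] with k hk
    have h1 := walkLaw_favoriteState_separated_le (d := d) k m (j k - 1)
    rw [Nat.sub_add_cancel (hj k hk)] at h1
    refine h1.trans ?_
    have hk0 : (0 : ℝ) < k := by exact_mod_cast (by omega : 0 < k)
    have e1 : (k : ℝ) ^ (a * Real.log g) = g ^ (a * Real.log k) := by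
      rw [Real.rpow_def_of_pos hk0, Real.rpow_def_of_pos hg0]; ring_nf
    have e2 : g ^ (j k - 1) = g⁻¹ * g ^ (j k) := by
      rw [eq_inv_mul_iff_mul_eq₀ hg0.ne', ← pow_succ', Nat.sub_add_cancel (hj k hk)]
    rw [e1, ← hg, e2, ← Real.rpow_natCast]
    exact mul_le_mul_of_nonneg_left
      (Real.rpow_le_rpow_of_exponent_ge hg0 hg1 (Nat.le_ceil _)) (inv_pos.2 hg0).le
  obtain ⟨C, _, hC⟩ := ae_eventually_level hd
  filter_upwards [ae_eventually_notMem_of_summable _ hS hb, hC] with x hx1 hx2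
  filter_upwards [hx1, hx2, eventually_ge_atTop (max 2 m)] with k h1 h2 hk n hn
  by_contra hcon
  obtain ⟨t, _, ht⟩ := exists_favoriteState_of_le (hj k ((le_max_left _ _).trans hk)) hn
    (Nat.ceil_le.2 (not_lt.1 hcon))
  refine h1 ⟨t, ht, ?_⟩
  have hsep : Separated k (favoriteSites (walk x) t) := by
    by_contra h
    exact h2.1 ⟨t, ht.1, h⟩
  exact hsep.mono ((le_max_right _ _).trans hk)

end Upper

/-! ### Lower bound: records occur at infinitely many levels -/

section Lower

variable {d : ℕ} {w : ℕ → Fin d → ℤ}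

/-- If at time `n` the level is in `[K, M)`, then the favorite sites are separated, and there are
less than `j` of them. -/
def Calm (j : ℕ → ℕ) (K M n : ℕ) (w : ℕ → Fin d → ℤ) : Prop :=
  K ≤ maxLocalTime w n → maxLocalTime w n < M →
    Separated (maxLocalTime w n) (favoriteSites w n) ∧
      (favoriteSites w n).ncard < j (maxLocalTime w n)

theorem calm_congr {w w' : ℕ → Fin d → ℤ} {n : ℕ} (h : ∀ m ≤ n, w m = w' m) (j : ℕ → ℕ)
    (K M : ℕ) : Calm j K M n w ↔ Calm j K M n w' := by
  unfold Calm
  rw [maxLocalTime_congr h, favoriteSites_congr h]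

/-- The walk has been calm below level `M`, and at time `t` there are `i` favorite sites at level
`M`, or at most `i` which are not separated. -/
def CalmState (j : ℕ → ℕ) (K M i t : ℕ) (w : ℕ → Fin d → ℤ) : Prop :=
  (∀ n ≤ t, Calm j K M n w) ∧ maxLocalTime w t = M ∧
    ((favoriteSites w t).ncard = i ∨
      (favoriteSites w t).ncard ≤ i ∧ ¬ Separated M (favoriteSites w t))

theorem dependsOn_calmState (j : ℕ → ℕ) (K M i t : ℕ) :
    DependsOn (fun x : ℕ → Fin d → ℤ => CalmState j K M i t (walk x)) (Set.Iio t) := by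
  refine dependsOn_of_walk t fun w w' h => ?_
  unfold CalmState
  rw [maxLocalTime_congr h, favoriteSites_congr h]
  have : (∀ n ≤ t, Calm j K M n w) ↔ ∀ n ≤ t, Calm j K M n w' :=
    forall₂_congr fun n hn => calm_congr (fun m hm => h m (hm.trans hn)) j K M
  rw [this]

theorem CalmState.calm {j : ℕ → ℕ} {K M i t : ℕ} (h : CalmState j K M i t w) (n : ℕ) :
    Calm j K M n w := by
  rcases le_total n t with hn | hn
  · exact h.1 n hn
  · intro _ hM
    have := maxLocalTime_mono w hn
    rw [h.2.1] at this
    omega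

theorem CalmState.mem_favoriteSites {j : ℕ → ℕ} {K M i t : ℕ}
    (ht : FirstAt (CalmState j K M i) t w) (hsep : Separated M (favoriteSites w t)) :
    (favoriteSites w t).ncard = i ∧ w t ∈ favoriteSites w t := by
  have hi : (favoriteSites w t).ncard = i := ht.1.2.2.resolve_right fun h => h.2 hsep
  exact ⟨hi, mem_favoriteSites_of_first ⟨ht.1.2.1, hi⟩ fun s hs hst =>
    ht.2 s hs ⟨fun n hn => ht.1.1 n (hn.trans hs.le), hst.1, Or.inl hst.2⟩⟩

/-- The non-separated alternative passes to i + 1 at the same time, so a failure of separation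
counts as success and the stages can be chained without conditioning on separation. -/
theorem CalmState.exists_succ {j : ℕ → ℕ} {K M i t : ℕ} (ht : CalmState j K M i t w)
    (hno : Separated M (favoriteSites w t) → ∀ s, t < s → w s ∉ favoriteSites w t)
    (htop : ∃ n, M < maxLocalTime w n) : ∃ s, CalmState j K M (i + 1) s w := by
  by_cases hsep : Separated M (favoriteSites w t)
  · have hi : (favoriteSites w t).ncard = i := ht.2.2.resolve_right fun h => h.2 hsep
    obtain ⟨s, _, hs⟩ := exists_favoriteState_succ ⟨ht.2.1, hi⟩ (hno hsep) htop
    exact ⟨s, fun n _ => ht.calm n, hs.1, Or.inl hs.2⟩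
  · refine ⟨t, ht.1, ht.2.1, Or.inr ⟨?_, hsep⟩⟩
    rcases ht.2.2 with h | h
    · omega
    · omega

/-- The probability never to revisit a separated set of favorite sites. -/
theorem le_walkLaw_forall_notMem (hd : 3 ≤ d) {M : ℕ} (hM : M ≠ 0) {F : Set (Fin d → ℤ)}
    (hF : F.Finite) (hsep : Separated M F) {v : Fin d → ℤ} (hv : v ∈ F) :
    1 - returnProb d - F.ncard * (1000 * (M : ℝ) ^ (-(1 / 2) : ℝ)) ≤
      (walkLaw d).real {y | ∀ n, v + walk y (n + 1) ∉ F} := by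
  classical
  have : NeZero d := ⟨by omega⟩
  have hmeas : MeasurableSet {y : ℕ → Fin d → ℤ | ∃ n, v + walk y (n + 1) ∈ F} :=
    measurableSet_exists_walk (fun u => v + u ∈ F) 1
  have hcompl : {y : ℕ → Fin d → ℤ | ∀ n, v + walk y (n + 1) ∉ F} =
      {y | ∃ n, v + walk y (n + 1) ∈ F}ᶜ := by
    ext y; simp
  rw [hcompl, probReal_compl_eq_one_sub hmeas]
  -- Coming back to v itself costs q; every other site of F is far away and costs one small hitting
  -- probability.
  have hsub : {y : ℕ → Fin d → ℤ | ∃ n, v + walk y (n + 1) ∈ F} ⊆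
      {y | ∃ n, walk y (n + 1) = 0} ∪
        ⋃ u ∈ hF.toFinset.erase v, {y | ∃ n, walk y n = u - v} := by
    rintro y ⟨n, hn⟩
    by_cases h : walk y (n + 1) = 0
    · exact Or.inl ⟨n, h⟩
    · refine Or.inr (Set.mem_biUnion (x := v + walk y (n + 1)) ?_ ⟨n + 1, by simp⟩)
      simp [h, hn]
  have hle : (walkLaw d).real {y : ℕ → Fin d → ℤ | ∃ n, v + walk y (n + 1) ∈ F} ≤
      returnProb d + F.ncard * (1000 * (M : ℝ) ^ (-(1 / 2) : ℝ)) := by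
    refine (measureReal_mono hsub).trans ((measureReal_union_le _ _).trans
      (add_le_add_right ?_ _))
    calc _ ≤ ∑ u ∈ hF.toFinset.erase v, (walkLaw d).real {y | ∃ n, walk y n = u - v} :=
          measureReal_biUnion_finset_le _ _
      _ ≤ ∑ u ∈ hF.toFinset.erase v, 1000 * (M : ℝ) ^ (-(1 / 2) : ℝ) := by
          refine Finset.sum_le_sum fun u hu => ?_
          rw [Finset.mem_erase, Set.Finite.mem_toFinset] at hu
          obtain ⟨i, hi⟩ := hsep u hu.2 v hv hu.1
          exact hitProb_le_of_lt hd hM hi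
      _ ≤ _ := by
          rw [Finset.sum_const, nsmul_eq_mul]
          gcongr
          rw [Set.ncard_eq_toFinset_card F hF]
          exact Finset.card_erase_le
  linarith

theorem ae_exists_lt_maxLocalTime (hd : 3 ≤ d) :
    ∀ᵐ x ∂(walkLaw d), ∀ k, ∃ n, k < maxLocalTime (walk x) n := by
  obtain ⟨C, _, hC⟩ := ae_eventually_level hd
  filter_upwards [hC] with x hx k
  obtain ⟨l, hl, hkl⟩ := (hx.and (eventually_ge_atTop k)).exists
  obtain ⟨N, _, hN⟩ := hl.2
  exact ⟨N, hkl.trans_lt hN⟩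

theorem walkLaw_calmState_succ (hd : 3 ≤ d) {j : ℕ → ℕ} {K M i : ℕ} (hM : M ≠ 0) {p : ℝ}
    (hp0 : 0 ≤ p)
    (hp : p ≤ 1 - returnProb d - i * (1000 * (M : ℝ) ^ (-(1 / 2) : ℝ))) :
    p * (walkLaw d).real {x | ∃ t, CalmState j K M i t (walk x)} ≤
      (walkLaw d).real {x | ∃ t, CalmState j K M (i + 1) t (walk x)} := by
  have : NeZero d := ⟨by omega⟩
  have hp1 : p ≤ 1 := by
    have h1 : 0 ≤ returnProb d := measureReal_nonneg
    have h2 : 0 ≤ i * (1000 * (M : ℝ) ^ (-(1 / 2) : ℝ)) := by positivity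
    linarith
  let Q : ℕ → (ℕ → Fin d → ℤ) → Set (ℕ → Fin d → ℤ) := fun t x =>
    {y | Separated M (favoriteSites (walk x) t) →
      ∀ n, walk x t + walk y (n + 1) ∉ favoriteSites (walk x) t}
  have hQ : ∀ t, DependsOn (Q t) (Set.Iio t) := fun t =>
    dependsOn_of_walk t (F := fun w => {y : ℕ → Fin d → ℤ | Separated M (favoriteSites w t) →
      ∀ n, w t + walk y (n + 1) ∉ favoriteSites w t}) fun w w' h => by
        rw [favoriteSites_congr h, h t le_rfl]
  have hQm : ∀ t x, MeasurableSet (Q t x) := by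
    intro t x
    by_cases hsep : Separated M (favoriteSites (walk x) t)
    · have h := (measurableSet_exists_walk (d := d)
        (fun u => walk x t + u ∈ favoriteSites (walk x) t) 1).compl
      convert h using 1
      ext y
      simp [Q, hsep]
    · have : Q t x = Set.univ := Set.eq_univ_of_forall fun y h => absurd h hsep
      rw [this]
      exact MeasurableSet.univ
  refine (le_walkLaw_stage (dependsOn_calmState j K M i) hQ hQm hp0 ?_).trans ?_
  · intro t x ht
    by_cases hsep : Separated M (favoriteSites (walk x) t)
    · have ht' : FirstAt (CalmState j K M i) t (walk x) := ht
      obtain ⟨hi, hmem⟩ := CalmState.mem_favoriteSites ht' hsep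
      have h := le_walkLaw_forall_notMem hd hM (finite_favoriteSites (walk x) t) hsep hmem
      rw [hi] at h
      refine (hp.trans h).trans (measureReal_mono fun y hy _ => hy)
    · have : Q t x = Set.univ := Set.eq_univ_of_forall fun y h => absurd h hsep
      rw [this]
      simpa using hp1
  · refine ENNReal.toReal_mono (measure_ne_top _ _) (measure_mono_ae ?_)
    filter_upwards [ae_exists_lt_maxLocalTime hd] with x hx
    rintro ⟨t, ht, h⟩
    refine CalmState.exists_succ ht.1 (fun hsep s hs => ?_) (hx M)
    have := h hsep (s - t - 1)
    rwa [← walk_add, show t + (s - t - 1 + 1) = s by omega] at this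

/-- A conditional form of the second Borel–Cantelli lemma. Starting from the first favorite of level
M, j M - 1 stages of probability at least p lead to a state that violates calmness at level M, and
only calmness at lower levels is assumed. -/
theorem walkLaw_forall_calm_succ_le (hd : 3 ≤ d) {j : ℕ → ℕ} {K M : ℕ} (hK : 1 ≤ K) (hM : K ≤ M)
    (hj : 1 ≤ j M) {p : ℝ} (hp0 : 0 ≤ p)
    (hp : p ≤ 1 - returnProb d - j M * (1000 * (M : ℝ) ^ (-(1 / 2) : ℝ))) :
    (walkLaw d).real {x | ∀ n, Calm j K (M + 1) n (walk x)} ≤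
      (1 - p ^ (j M - 1)) * (walkLaw d).real {x | ∀ n, Calm j K M n (walk x)} := by
  have : NeZero d := ⟨by omega⟩
  have hstage : ∀ i, i + 1 ≤ j M →
      p ^ i * (walkLaw d).real {x | ∀ n, Calm j K M n (walk x)} ≤
        (walkLaw d).real {x | ∃ t, CalmState j K M (i + 1) t (walk x)} := by
    intro i hi
    induction i with
    | zero =>
      rw [pow_zero, one_mul]
      refine ENNReal.toReal_mono (measure_ne_top _ _) (measure_mono_ae ?_)
      filter_upwards [ae_exists_lt_maxLocalTime hd] with x hx
      intro hcalm
      obtain ⟨n, hn⟩ := hx M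
      obtain ⟨t, ht⟩ := exists_favoriteState_one (hK.trans hM) ⟨n, hn.le⟩
      exact ⟨t, fun n _ => hcalm n, ht.1, Or.inl ht.2⟩
    | succ i ih =>
      rw [pow_succ', mul_assoc]
      refine (mul_le_mul_of_nonneg_left (ih (by omega)) hp0).trans
        (walkLaw_calmState_succ hd (by omega) hp0 (hp.trans ?_))
      have : ((i + 1 : ℕ) : ℝ) ≤ j M := by exact_mod_cast (by omega)
      gcongr
  have h1 := hstage (j M - 1) (by omega)
  rw [Nat.sub_add_cancel hj] at h1
  have hmeas : MeasurableSet {x : ℕ → Fin d → ℤ | ∃ t, CalmState j K M (j M) t (walk x)} :=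
    measurableSet_exists_of_dependsOn fun t => ⟨t, dependsOn_calmState j K M (j M) t⟩
  have h2 : (walkLaw d).real {x | ∀ n, Calm j K (M + 1) n (walk x)} +
      (walkLaw d).real {x | ∃ t, CalmState j K M (j M) t (walk x)} ≤
        (walkLaw d).real {x | ∀ n, Calm j K M n (walk x)} := by
    rw [← measureReal_union _ hmeas]
    · refine measureReal_mono ?_
      rintro x (hx | ⟨t, ht⟩) n
      · exact fun hK' hM' => hx n hK' (by omega)
      · exact ht.calm n
    · rw [Set.disjoint_left]
      rintro x hx ⟨t, ht⟩
      have h := hx t (by rw [ht.2.1]; exact hM) (by rw [ht.2.1]; omega)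
      rw [ht.2.1] at h
      rcases ht.2.2 with h' | h'
      · omega
      · exact h'.2 h.1
  linarith

theorem ae_frequently_le_ncard (hd : 3 ≤ d) {a : ℝ} (ha0 : 0 < a)
    (ha : a < -1 / Real.log (1 - returnProb d)) :
    ∀ᵐ x ∂(walkLaw d), ∃ᶠ k : ℕ in atTop, ∃ n, maxLocalTime (walk x) n = k ∧
      a * Real.log k ≤ ((favoriteSites (walk x) n).ncard : ℝ) := by
  have : NeZero d := ⟨by omega⟩
  have hq0 := returnProb_pos (d := d)
  have hq1 : returnProb d < 1 := (returnProb_le_hitBound hd).trans_lt hitBound_lt_one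
  set γ := 1 - returnProb d with hγ
  have hγ0 : 0 < γ := by linarith
  have hlog : Real.log γ < 0 := Real.log_neg hγ0 (by linarith)
  -- Chosen so that p^(a log M) = 1/M; the hypothesis on a says exactly that p < γ.
  set p := Real.exp (-1 / a) with hp
  have hp0 : 0 < p := Real.exp_pos _
  have hpγ : p < γ := by
    rw [hp, ← Real.lt_log_iff_exp_lt hγ0, div_lt_iff₀ ha0]
    rw [lt_div_iff_of_neg hlog] at ha
    linarith
  have hp1 : p ≤ 1 := by linarith
  let j : ℕ → ℕ := fun k => ⌈a * Real.log k⌉₊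
  have hj : ∀ k : ℕ, 2 ≤ k → 1 ≤ j k := fun k hk => by
    refine Nat.one_le_ceil_iff.2 (mul_pos ha0 (Real.log_pos ?_))
    exact_mod_cast hk
  have hsmall : ∀ᶠ M : ℕ in atTop, p ≤ γ - j M * (1000 * (M : ℝ) ^ (-(1 / 2) : ℝ)) := by
    have h1 : Tendsto (fun M : ℕ => Real.log M / (M : ℝ) ^ (1 / 2 : ℝ)) atTop (nhds 0) :=
      ((isLittleO_log_rpow_atTop (by norm_num : (0 : ℝ) < 1 / 2)).tendsto_div_nhds_zero).comp
        tendsto_natCast_atTop_atTop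
    have h2 : Tendsto (fun M : ℕ => (M : ℝ) ^ (-(1 / 2) : ℝ)) atTop (nhds 0) :=
      (tendsto_rpow_neg_atTop (by norm_num : (0 : ℝ) < 1 / 2)).comp tendsto_natCast_atTop_atTop
    have h3 : Tendsto (fun M : ℕ => 1000 * a * (Real.log M / (M : ℝ) ^ (1 / 2 : ℝ)) +
        1000 * (M : ℝ) ^ (-(1 / 2) : ℝ)) atTop (nhds 0) := by
      simpa using (h1.const_mul (1000 * a)).add (h2.const_mul 1000)
    filter_upwards [h3.eventually_lt_const (show 0 < γ - p by linarith), eventually_ge_atTop 2]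
      with M hM hM2
    have hlog0 : 0 ≤ a * Real.log M := mul_nonneg ha0.le (Real.log_natCast_nonneg M)
    have h4 : (j M : ℝ) ≤ a * Real.log M + 1 := (Nat.ceil_lt_add_one hlog0).le
    have h5 : (j M : ℝ) * (1000 * (M : ℝ) ^ (-(1 / 2) : ℝ)) ≤
        (a * Real.log M + 1) * (1000 * (M : ℝ) ^ (-(1 / 2) : ℝ)) := by gcongr
    have h6 : (a * Real.log M + 1) * (1000 * (M : ℝ) ^ (-(1 / 2) : ℝ)) =
        1000 * a * (Real.log M / (M : ℝ) ^ (1 / 2 : ℝ)) + 1000 * (M : ℝ) ^ (-(1 / 2) : ℝ) := by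
      rw [Real.rpow_neg (by positivity)]
      ring
    linarith
  have hpow : ∀ M : ℕ, 2 ≤ M → (M : ℝ)⁻¹ ≤ p ^ (j M - 1) := fun M hM => by
    have hM0 : (0 : ℝ) < M := by exact_mod_cast (by omega : 0 < M)
    have hlog0 : 0 ≤ a * Real.log M := mul_nonneg ha0.le (Real.log_natCast_nonneg M)
    have h4 : (j M : ℝ) < a * Real.log M + 1 := Nat.ceil_lt_add_one hlog0
    have h5 : ((j M - 1 : ℕ) : ℝ) ≤ a * Real.log M := by
      rw [Nat.cast_sub (hj M hM)]; push_cast; linarith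
    calc (M : ℝ)⁻¹ = p ^ (a * Real.log M) := by
          rw [hp, ← Real.exp_mul, show -1 / a * (a * Real.log M) = -Real.log M by field_simp,
            Real.exp_neg, Real.exp_log hM0]
      _ ≤ p ^ ((j M - 1 : ℕ) : ℝ) := Real.rpow_le_rpow_of_exponent_ge hp0 hp1 h5
      _ = _ := Real.rpow_natCast _ _
  obtain ⟨K₁, hK₁⟩ := eventually_atTop.1 hsmall
  have hnull : ∀ K, max 2 K₁ ≤ K →
      (walkLaw d).real {x | ∀ M n, Calm j K M n (walk x)} = 0 := by
    intro K hK
    have hK2 : 2 ≤ K := (le_max_left _ _).trans hK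
    -- Each level M contributes a factor at most 1 - 1/M = (M - 1)/M, so the probability times M - 1
    -- does not increase with M.
    have hrec : ∀ l : ℕ, (walkLaw d).real {x | ∀ n, Calm j K (K + l) n (walk x)} *
        ((K + l : ℕ) - 1 : ℝ) ≤ K := by
      intro l
      induction l with
      | zero =>
        have h1 : (walkLaw d).real {x : ℕ → Fin d → ℤ | ∀ n, Calm j K (K + 0) n (walk x)} ≤ 1 :=
          measureReal_le_one
        have h2 : (2 : ℝ) ≤ K := by exact_mod_cast hK2
        have h3 : (0 : ℝ) ≤ (walkLaw d).real
          {x : ℕ → Fin d → ℤ | ∀ n, Calm j K (K + 0) n (walk x)} := measureReal_nonneg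
        push_cast
        nlinarith
      | succ l ih =>
        have hM2 : 2 ≤ K + l := by omega
        have h1 := walkLaw_forall_calm_succ_le hd (j := j) (K := K) (M := K + l) (by omega)
          (by omega) (hj _ hM2) hp0.le (hK₁ (K + l) (by have := le_max_right 2 K₁; omega))
        have h2 := hpow (K + l) hM2
        have hpos : (0 : ℝ) < ((K + l : ℕ) : ℝ) := by exact_mod_cast (by omega : 0 < K + l)
        refine le_trans ?_ ih
        rw [← add_assoc]
        have h3 : (0 : ℝ) ≤ (walkLaw d).real
          {x : ℕ → Fin d → ℤ | ∀ n, Calm j K (K + l) n (walk x)} := measureReal_nonneg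
        have h4 : (1 - p ^ (j (K + l) - 1)) * ((K + l : ℕ) : ℝ) ≤ ((K + l : ℕ) : ℝ) - 1 := by
          have := mul_le_mul_of_nonneg_right h2 hpos.le
          rw [inv_mul_cancel₀ hpos.ne'] at this
          linarith
        rw [Nat.cast_succ, add_sub_cancel_right]
        calc _ ≤ (1 - p ^ (j (K + l) - 1)) * (walkLaw d).real
              {x | ∀ n, Calm j K (K + l) n (walk x)} * ((K + l : ℕ) : ℝ) := by gcongr
          _ = (walkLaw d).real {x | ∀ n, Calm j K (K + l) n (walk x)} *
              ((1 - p ^ (j (K + l) - 1)) * ((K + l : ℕ) : ℝ)) := by ring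
          _ ≤ _ := by gcongr
    refine le_antisymm ?_ measureReal_nonneg
    have htend : Tendsto (fun l : ℕ => (K : ℝ) / ((K + l : ℕ) - 1 : ℝ)) atTop (nhds 0) := by
      refine Tendsto.const_div_atTop ?_ _
      refine tendsto_atTop_add_const_right _ _ (tendsto_natCast_atTop_atTop.comp ?_)
      exact tendsto_atTop_mono (fun l => Nat.le_add_left l K) tendsto_id
    refine ge_of_tendsto' htend fun l => ?_
    have hpos : (0 : ℝ) < ((K + l : ℕ) : ℝ) - 1 := by
      have : (2 : ℝ) ≤ ((K + l : ℕ) : ℝ) := by exact_mod_cast (by omega)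
      linarith
    rw [le_div_iff₀ hpos]
    refine (mul_le_mul_of_nonneg_right (measureReal_mono ?_) hpos.le).trans (hrec l)
    exact fun x hx n => hx (K + l) n
  obtain ⟨C, _, hC⟩ := ae_eventually_level hd
  have hae : ∀ᵐ x ∂(walkLaw d), ∀ K, max 2 K₁ ≤ K → ¬ ∀ M n, Calm j K M n (walk x) := by
    rw [ae_all_iff]
    intro K
    by_cases hK : max 2 K₁ ≤ K
    · have h := hnull K hK
      rw [measureReal_eq_zero_iff] at h
      have h' : ∀ᵐ x ∂(walkLaw d), x ∉ {x | ∀ M n, Calm j K M n (walk x)} :=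
        measure_eq_zero_iff_ae_notMem.1 h
      filter_upwards [h'] with x hx _
      exact hx
    · exact Eventually.of_forall fun x h => absurd h hK
  filter_upwards [hae, hC] with x hx1 hx2
  obtain ⟨K₂, hK₂⟩ := eventually_atTop.1 hx2
  rw [frequently_atTop]
  intro K₃
  -- Beyond `K₂` favorites are separated, so a failure of calmness there can only come from their
  -- number.
  have h := hx1 (max (max 2 K₁) (max K₂ K₃)) (le_max_left _ _)
  unfold Calm at h
  push Not at h
  obtain ⟨M, n, h1, h2, h3⟩ := h
  refine ⟨maxLocalTime (walk x) n, ?_, n, rfl, ?_⟩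
  · exact (le_max_right _ _).trans ((le_max_right _ _).trans h1)
  · have hsep : Separated (maxLocalTime (walk x) n) (favoriteSites (walk x) n) := by
      by_contra hcon
      exact (hK₂ _ ((le_max_left _ _).trans ((le_max_right _ _).trans h1))).1 ⟨n, rfl, hcon⟩
    exact Nat.ceil_le.1 (h3 hsep)

end Lower

/-! ### From levels to times -/

section Limsup

variable {d : ℕ} {w : ℕ → Fin d → ℤ}

theorem tendsto_maxLocalTime (h : ∀ k, ∃ n, k < maxLocalTime w n) :
    Tendsto (maxLocalTime w) atTop atTop :=
  tendsto_atTop_atTop_of_monotone (maxLocalTime_mono w) fun k => (h k).imp fun _ hn => hn.le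

theorem eventually_le_mul_log {s : ℝ} (hs : 0 < s) (b : ℝ) :
    ∀ᶠ k : ℕ in atTop, b ≤ s * Real.log k := by
  have : Tendsto (fun k : ℕ => s * Real.log k) atTop atTop :=
    (Real.tendsto_log_atTop.comp tendsto_natCast_atTop_atTop).const_mul_atTop hs
  exact this.eventually_ge_atTop b

/-- Exponential waiting times give log log n ≥ log k + log c; the additive constant is absorbed by
passing from a to the larger b. -/
theorem limsup_favoriteSites_le {c : ℝ} (hc : 0 < c)
    (htop : ∀ k, ∃ n, k < maxLocalTime w n)
    (hgrowth : ∀ᶠ k : ℕ in atTop, ∀ n : ℕ, maxLocalTime w n = k → Real.exp (c * k) ≤ n)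
    {a b : ℝ} (hb : 0 < b) (hab : a < b)
    (hcard : ∀ᶠ k : ℕ in atTop, ∀ n, maxLocalTime w n = k →
      ((favoriteSites w n).ncard : ℝ) < a * Real.log k) :
    limsup (fun n : ℕ =>
      ((((favoriteSites w n).ncard : ℝ) / Real.log (Real.log (n : ℝ)) : ℝ) : EReal)) atTop ≤
        (b : EReal) := by
  refine limsup_le_of_le (h := ?_)
  have hk := (hgrowth.and hcard).and ((eventually_le_mul_log (sub_pos.2 hab)
    (-b * Real.log c)).and ((eventually_le_mul_log one_pos (1 - Real.log c)).and
      (eventually_ge_atTop 1)))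
  filter_upwards [(tendsto_maxLocalTime htop).eventually hk] with n hn
  obtain ⟨⟨h1, h2⟩, h3, h4, h5⟩ := hn
  replace h1 := h1 n rfl
  replace h2 := h2 n rfl
  set k := maxLocalTime w n
  have hk0 : (0 : ℝ) < k := by exact_mod_cast (by omega : 0 < k)
  have hl1 : c * k ≤ Real.log n := by
    rw [← Real.log_exp (c * k)]
    exact Real.log_le_log (Real.exp_pos _) h1
  have hl2 : Real.log c + Real.log k ≤ Real.log (Real.log n) := by
    rw [← Real.log_mul hc.ne' hk0.ne']
    exact Real.log_le_log (by positivity) hl1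
  have hl3 : 0 < Real.log (Real.log n) := by linarith
  rw [EReal.coe_le_coe_iff, div_le_iff₀ hl3]
  nlinarith

theorem le_limsup_favoriteSites {C : ℝ} (hC : 0 < C)
    (hgrowth : ∀ᶠ k : ℕ in atTop,
      ∃ N : ℕ, (N : ℝ) ≤ Real.exp (C * k) ∧ k < maxLocalTime w N)
    {a b : ℝ} (hb : 0 ≤ b) (hab : b < a)
    (hcard : ∃ᶠ k : ℕ in atTop, ∃ n, maxLocalTime w n = k ∧
      a * Real.log k ≤ ((favoriteSites w n).ncard : ℝ)) :
    (b : EReal) ≤ limsup (fun n : ℕ =>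
      ((((favoriteSites w n).ncard : ℝ) / Real.log (Real.log (n : ℝ)) : ℝ) : EReal)) atTop := by
  refine le_limsup_of_frequently_le' ?_
  rw [frequently_atTop]
  intro N₀
  obtain ⟨k, ⟨n, hn, h1⟩, ⟨N, hN, hkN⟩, h3, h4⟩ := (hcard.and_eventually
    (hgrowth.and ((eventually_le_mul_log (sub_pos.2 hab)
      (b * Real.log C)).and (eventually_ge_atTop (N₀ + 17))))).exists
  have hnk := maxLocalTime_le w n
  -- Level k needs at least k - 1 steps, so a high level occurs late; 16 exceeds e, which makes log
  -- log n positive.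
  have hn16 : N₀ + 16 ≤ n := by omega
  refine ⟨n, by omega, ?_⟩
  have hnN : n ≤ N := by
    by_contra hcon
    have := maxLocalTime_mono w (not_le.1 hcon).le
    omega
  have hk0 : (0 : ℝ) < k := by exact_mod_cast (by omega : 0 < k)
  have hn0 : (16 : ℝ) ≤ n := by exact_mod_cast (by omega : 16 ≤ n)
  have hl1 : 1 < Real.log n := by
    rw [Real.lt_log_iff_exp_lt (by linarith)]
    have := Real.exp_one_lt_d9
    linarith
  have hl2 : Real.log n ≤ C * k := by
    rw [← Real.log_exp (C * k)]
    refine Real.log_le_log (by linarith) (le_trans ?_ hN)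
    exact_mod_cast hnN
  have hl3 : Real.log (Real.log n) ≤ Real.log C + Real.log k := by
    rw [← Real.log_mul hC.ne' hk0.ne']
    exact Real.log_le_log (by linarith) hl2
  rw [EReal.coe_le_coe_iff, le_div_iff₀ (Real.log_pos hl1)]
  nlinarith

theorem ae_limsup_favoriteSites (hd : 3 ≤ d) :
    ∀ᵐ x ∂(walkLaw d), limsup (fun n : ℕ =>
      ((((favoriteSites (walk x) n).ncard : ℝ) / Real.log (Real.log (n : ℝ)) : ℝ) : EReal)) atTop =
        ((-1 / Real.log (1 - returnProb d) : ℝ) : EReal) := by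
  have : NeZero d := ⟨by omega⟩
  have hq0 := returnProb_pos (d := d)
  have hq1 : returnProb d < 1 := (returnProb_le_hitBound hd).trans_lt hitBound_lt_one
  set α := -1 / Real.log (1 - returnProb d) with hα
  have hα0 : 0 < α :=
    div_pos_of_neg_of_neg (by norm_num) (Real.log_neg (by linarith) (by linarith))
  obtain ⟨C, hC0, hC⟩ := ae_eventually_level hd
  obtain ⟨c, hc0, hc⟩ := ae_eventually_exp_le hd
  -- Rational thresholds keep the number of exceptional null sets countable.
  have hupper : ∀ᵐ x ∂(walkLaw d), ∀ a : ℚ, α < a → ∀ᶠ k : ℕ in atTop, ∀ n,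
      maxLocalTime (walk x) n = k →
        ((favoriteSites (walk x) n).ncard : ℝ) < a * Real.log k := by
    rw [ae_all_iff]
    intro a
    by_cases ha : α < a
    · filter_upwards [ae_eventually_ncard_lt hd ha] with x hx _ using hx
    · exact Eventually.of_forall fun x h => absurd h ha
  have hlower : ∀ᵐ x ∂(walkLaw d), ∀ a : ℚ, 0 < (a : ℝ) → (a : ℝ) < α → ∃ᶠ k : ℕ in atTop, ∃ n,
      maxLocalTime (walk x) n = k ∧
        a * Real.log k ≤ ((favoriteSites (walk x) n).ncard : ℝ) := by
    rw [ae_all_iff]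
    intro a
    by_cases ha : 0 < (a : ℝ) ∧ (a : ℝ) < α
    · filter_upwards [ae_frequently_le_ncard hd ha.1 ha.2] with x hx _ _ using hx
    · exact Eventually.of_forall fun x h h' => absurd ⟨h, h'⟩ ha
  filter_upwards [hC, hc, hupper, hlower, ae_exists_lt_maxLocalTime hd] with x h1 h2 h3 h4 h5
  apply le_antisymm
  · refine EReal.le_of_forall_lt_iff_le.1 fun b hb => ?_
    rw [EReal.coe_lt_coe_iff] at hb
    obtain ⟨a, ha, hab⟩ := exists_rat_btwn hb
    exact limsup_favoriteSites_le hc0 h5 h2 (hα0.trans hb) hab (h3 a ha)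
  · refine EReal.ge_of_forall_gt_iff_ge.1 fun b hb => ?_
    rw [EReal.coe_lt_coe_iff] at hb
    -- The lower bound needs a positive threshold, so a negative b is first raised to 0.
    obtain ⟨a, ha, haα⟩ := exists_rat_btwn (max_lt hb hα0)
    have ha0 : 0 < (a : ℝ) := (le_max_right _ _).trans_lt ha
    refine le_trans (EReal.coe_le_coe_iff.2 (le_max_left b 0)) ?_
    exact le_limsup_favoriteSites hC0 (h1.mono fun k hk => hk.2) (le_max_right b 0) ha
      (h4 a ha0 haα)

end Limsup

/-! ### Transfer to an arbitrary simple random walk -/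

theorem eq_add_walk_increments {Ω : Type*} {d : ℕ} (S : ℕ → Ω → (Fin d → ℤ)) (ω : Ω) (n : ℕ) :
    S n ω = S 0 ω + walk (fun m => S (m + 1) ω - S m ω) n := by
  rw [walk, Finset.sum_range_sub (fun m => S m ω), add_sub_cancel]

theorem IsSimpleRandomWalk.escapeProb_eq {Ω : Type*} [MeasurableSpace Ω] {d : ℕ} [NeZero d]
    {S : ℕ → Ω → (Fin d → ℤ)} {μ : Measure Ω} [IsProbabilityMeasure μ]
    (hS : IsSimpleRandomWalk S μ) : escapeProb S μ = 1 - returnProb d := by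
  have hm : Measurable (fun ω n => S (n + 1) ω - S n ω) :=
    measurable_pi_iff.2 fun n => (hS.measurable (n + 1)).sub (hS.measurable n)
  have hmeas := measurableSet_exists_walk (d := d) (fun v => v = 0) 1
  rw [returnProb, ← probReal_compl_eq_one_sub hmeas, ← hS.map_increments (NeZero.ne d),
    map_measureReal_apply hm hmeas.compl, escapeProb]
  congr 1
  ext ω
  change (∀ n, 1 ≤ n → S n ω ≠ S 0 ω) ↔
    ¬ ∃ n, walk (fun m => S (m + 1) ω - S m ω) (n + 1) = 0
  push Not
  constructor
  · intro h n hn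
    apply h (n + 1) (by omega)
    rw [eq_add_walk_increments S ω (n + 1), hn, add_zero]
  · intro h n hn hret
    apply h (n - 1)
    rw [Nat.sub_add_cancel hn]
    rwa [eq_add_walk_increments S ω n, add_eq_left] at hret

theorem theorem1p2 (d : ℕ) (hd : 3 ≤ d) {Ω : Type*} [MeasurableSpace Ω]
    (μ : Measure Ω) [IsProbabilityMeasure μ] (S : ℕ → Ω → (Fin d → ℤ))
    (hS : IsSimpleRandomWalk S μ) :
    0 < escapeProb S μ ∧ escapeProb S μ < 1 ∧
      ∀ᵐ ω ∂μ,
        limsup (fun n : ℕ =>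
            ((((favoriteSites (fun j => S j ω) n).ncard : ℝ) / Real.log (Real.log (n : ℝ)) : ℝ)
              : EReal)) atTop
          = ((-1 / Real.log (escapeProb S μ) : ℝ) : EReal) := by
  have : NeZero d := ⟨by omega⟩
  have hq0 := returnProb_pos (d := d)
  have hq1 : returnProb d < 1 := (returnProb_le_hitBound hd).trans_lt hitBound_lt_one
  rw [hS.escapeProb_eq]
  refine ⟨by linarith, by linarith, ?_⟩
  have hm : Measurable (fun ω n => S (n + 1) ω - S n ω) :=
    measurable_pi_iff.2 fun n => (hS.measurable (n + 1)).sub (hS.measurable n)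
  have h := ae_limsup_favoriteSites hd
  rw [← hS.map_increments (NeZero.ne d)] at h
  filter_upwards [ae_of_ae_map hm.aemeasurable h] with ω hω
  rw [← hω]
  congr 1
  ext n
  -- The walk is a translate of the one started at the origin, and translation preserves the number
  -- of favorites.
  have hS' : (fun j => S j ω) = fun j => S 0 ω + walk (fun m => S (m + 1) ω - S m ω) j :=
    funext fun j => eq_add_walk_increments S ω j
  rw [hS', ncard_favoriteSites_translate]
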